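/- **Setting.** Let $\Sigma$ be an alphabet. For strings over $\Sigma$ write $u\to v$ if $u=x\,y\,y^{R}\,y\,z$ and $v=x\,y\,z$ for some $x,z\in\Sigma^*$ and some nonempty $y$, where $y^R$ is the reverse of $y$. A string is *irreducible* if it reduces to no string. A *Z-normal form* of $T$ is an irreducible string $u$ with $T\to^* u$. **The algorithm.** The global variables are a working string $w$, an array $\mathit{Pals}$ of natural numbers indexed by the positions of $w$, and a stack $S$ of positions; $w$, $\mathit{Pals}$ and $S$ are empty at the start, and positions are counted from $1$. The operation "append" reads the next letter of the input and puts it at the end of $w$. * $\mathsf{ZReduce}(T)$: replace the input by $\texttt{\$}T\texttt{\#}$, where $\texttt{\$},\texttt{\#}$ are two new letters; append. While unread letters remain: append; clear $S$; call $\mathsf{Stabilize}(|w|-1)$. Finally return $w[2:|w|-1]$. * $\mathsf{Stabilize}(c)$: let $b:=|w|$. Repeat the following round. If $\mathsf{SlowExtend}(c)$ returns true, return true. For $d=c+\mathit{Pals}[c]$ down to $b$: if $d+\mathit{Pals}[d]\ge c+\mathit{Pals}[c]$, then (i) if $\mathsf{FastExtend}(d)$ returns true and thereupon the call $\mathsf{Stabilize}(d)$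 returns true: return true if $c=|w|$; otherwise, set $\mathit{Pals}[d]:=\mathit{Pals}[2c-d]$ if $d=|w|$, append, and start a new round; (ii) in all other cases push $d$ onto $S$. If the for loop runs to its end, return false. * $\mathsf{SlowExtend}(c)$: let $r:=|w|-c-1$. While $w[c+r+1]=w[c-r]$: increase $r$ by $1$; if $\mathit{Pals}[c-r]\ge r$, set $w:=w[1:c-r]$, $\mathit{Pals}:=\mathit{Pals}[1:c-r]$ and return true; otherwise set $\mathit{Pals}[c+r]:=\mathit{Pals}[c-r]$ and append. After the loop set $\mathit{Pals}[c]:=r$ and return false. * $\mathsf{FastExtend}(d)$: while $S$ is not empty: let $r:=\mathrm{top}(S)-d$; if $\mathit{Pals}[d-r]\ge\mathit{Pals}[d+r]$, pop $S$; otherwise set $\mathit{Pals}[d]:=r+\mathit{Pals}[d-r]$ and return false. When $S$ is empty return true. Time is the number of elementary operations, each of unit cost: reading or comparing letters, reading and writing cells of $\mathit{Pals}$, stack operations, arithmetic on numbers, function calls and evaluations of loop conditions; deleting or copying several cells is charged one unit per cell. Reading past the end of the input, reading a nonexistent letter or an unwritten cell, writing to a cell of $\mathit{Pals}$ that is not a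 position of $w$ or a number larger than $|w|$, a negative difference, or using the top of an empty stack would be a fault. **Theorem.** There is a constant $C$, independent of the alphabet, such that for every alphabet $\Sigma$ and every $T\in\Sigma^*$ the execution of $\mathsf{ZReduce}(T)$ terminates without a fault, and: 1. it returns the Z-normal form of $T$; that is, the returned string $u$ is a Z-normal form of $T$, and it is the only one; 2. it takes at most $C\,(|T|+1)$ elementary operations, i.e. time $O(|T|)$; 3. $\mathsf{Stabilize}$ is called at most $|T|+1$ times; 4. the number of pop operations is at most the number of push operations, which is at most $|T|+1$. -/

import Mathlib

namespace ZRed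

/-! ## The rewriting system -/

section Rewriting

variable {α : Type*}

/-- `u → v`: `u = x y yᴿ y z` and `v = x y z` for some strings `x, z` and some nonempty string `y`. -/
def Reduces (u v : List α) : Prop :=
  ∃ x y z : List α, y ≠ [] ∧ u = x ++ y ++ y.reverse ++ y ++ z ∧ v = x ++ y ++ z

/-- A string is irreducible if it reduces to no string. -/
def Irreducible (u : List α) : Prop := ¬ ∃ v, Reduces u v

/-- `u` is an irreducible string obtained from `T` by finitely many (possibly no) reductions. -/
def IsZNormalForm (T u : List α) : Prop :=
  Relation.ReflTransGen Reduces T u ∧ Irreducible u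

end Rewriting

/-! ## The machine: global variables and elementary operations -/

/-- The letters of the input alphabet together with the two sentinel letters. -/
inductive Letter (α : Type) where
  | dollar : Letter α
  | letter : α → Letter α
  | hash : Letter α
deriving DecidableEq

/-- The global variables `T` (unread part of the input), `w`, `Pals` and `Stack`, and counters
which the program never reads.  All strings and arrays are indexed from `1`; a cell of `Pals` is
`none` as long as it has not been written. -/
structure State (α : Type) where
  /-- the letters of the input that have not been read yet -/
  unread : List (Letter α)
  /-- the working string -/
  w : List (Letter α)
  /-- the array `Pals` -/
  pals : ℕ → Option ℕ
  /-- the stack, its top first -/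
  stack : List ℕ
  /-- the number of elementary steps performed so far -/
  time : ℕ
  /-- the number of calls of `Stabilize` so far -/
  calls : ℕ
  /-- the number of push operations so far -/
  pushes : ℕ
  /-- the number of pop operations so far -/
  pops : ℕ

/-- Programs over the global variables that may fault or run forever (both are `none`). -/
abbrev Prog (α β : Type) := StateT (State α) Option β

section Machine

variable {α : Type}

/-- Spend `k` units of time.  Every elementary operation below costs one unit (those which copy or
delete several cells cost one unit more than the number of cells), and so does every call of a
function and every evaluation of a loop condition; the program performs only a bounded number of
additions and comparisons of numbers between two of these. -/
def tick (k : ℕ := 1) : Prog α Unit := fun s =>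
  some ((), { s with time := s.time + k })

/-- The difference of two numbers; a fault if it is negative. -/
def sub (a b : ℕ) : Prog α ℕ := do
  tick
  if b ≤ a then pure (a - b) else failure

/-- Is there an unread letter? -/
def inputRemains : Prog α Bool := do
  tick
  let s ← get
  pure (!s.unread.isEmpty)

/-- `w.append(T)`: move the next input letter to the end of `w`; a fault if there is none. -/
def append : Prog α Unit := do
  tick
  let s ← get
  match s.unread with
  | [] => failure
  | t :: rest => set { s with unread := rest, w := s.w ++ [t] }

/-- `|w|` -/
def lengthW : Prog α ℕ := do
  tick
  let s ← get
  pure s.w.length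

/-- `w[i]`; a fault unless `1 ≤ i ≤ |w|`. -/
def letterAt (i : ℕ) : Prog α (Letter α) := do
  tick
  let s ← get
  if 1 ≤ i then
    match s.w[i - 1]? with
    | some a => pure a
    | none => failure
  else failure

/-- `Pals[i]`; a fault if that cell has not been written. -/
def palsAt (i : ℕ) : Prog α ℕ := do
  tick
  let s ← get
  match s.pals i with
  | some v => pure v
  | none => failure

/-- `Pals[i] := v`.  The cells of `Pals` belong to the positions of `w` and hold numbers that are at
most `|w|`; anything else is a fault. -/
def setPals (i v : ℕ) : Prog α Unit := do
  tick
  let s ← get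
  if 1 ≤ i ∧ i ≤ s.w.length ∧ v ≤ s.w.length then
    set { s with pals := Function.update s.pals i (some v) }
  else failure

/-- `w := w[1:k]` and `Pals := Pals[1:k]`; a fault unless `k ≤ |w|`. -/
def truncate (k : ℕ) : Prog α Unit := do
  let s ← get
  tick (s.w.length - k + 1)
  let s ← get
  if k ≤ s.w.length then
    set { s with w := s.w.take k, pals := fun i => if i ≤ k then s.pals i else none }
  else failure

/-- Is `Stack` empty? -/
def stackIsEmpty : Prog α Bool := do
  tick
  let s ← get
  pure s.stack.isEmpty

/-- `Stack.top()`; a fault if the stack is empty. -/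
def top : Prog α ℕ := do
  tick
  let s ← get
  match s.stack with
  | [] => failure
  | d :: _ => pure d

/-- `Stack.push(d)` -/
def push (d : ℕ) : Prog α Unit := do
  tick
  modify fun s => { s with stack := d :: s.stack, pushes := s.pushes + 1 }

/-- `Stack.pop()`; a fault if the stack is empty. -/
def pop : Prog α Unit := do
  tick
  let s ← get
  match s.stack with
  | [] => failure
  | _ :: rest => set { s with stack := rest, pops := s.pops + 1 }

/-- `Stack.clear()`, which deletes the entries one by one. -/
def clearStack : Prog α Unit := do
  let s ← get
  tick (s.stack.length + 1)
  modify fun s => { s with stack := [] }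

/-- Record a call of `Stabilize`. -/
def recordCall : Prog α Unit := do
  tick
  modify fun s => { s with calls := s.calls + 1 }

end Machine

/-! ## The algorithm -/

section Algorithm

variable {α : Type} [DecidableEq α]

/-- The loop of `SlowExtend(c)`, entered with the value `r` of its local variable. -/
def slowLoop (c r : ℕ) : Prog α Bool := do
  tick
  let a ← letterAt (c + r + 1)
  let i ← sub c r
  let a' ← letterAt i
  if a = a' then
    let r := r + 1
    let i ← sub c r
    let v ← palsAt i
    if r ≤ v then
      truncate i
      pure true
    else
      setPals (c + r) v
      append
      slowLoop c r
  else
    setPals c r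
    pure false
  partial_fixpoint

/-- `SlowExtend(c)` -/
def slowExtend (c : ℕ) : Prog α Bool := do
  tick
  let n ← lengthW
  let r ← sub n (c + 1)
  slowLoop c r

/-- The loop of `FastExtend(d)`. -/
def fastLoop (d : ℕ) : Prog α Bool := do
  tick
  if ← stackIsEmpty then
    pure true
  else
    let e ← top
    let r ← sub e d
    let i ← sub d r
    let v ← palsAt i
    let v' ← palsAt (d + r)
    if v' ≤ v then
      pop
      fastLoop d
    else
      setPals d (r + v)
      pure false
  partial_fixpoint

/-- `FastExtend(d)` -/
def fastExtend (d : ℕ) : Prog α Bool := do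
  tick
  fastLoop d

/-- The three ways to leave the for loop of `Stabilize`. -/
inductive ForExit where
  /-- the loop variable has run through its whole range -/
  | completed : ForExit
  /-- `break`, after `unstable := true` -/
  | broken : ForExit
  /-- `return true` -/
  | returned : ForExit

mutual

/-- `Stabilize(c)` -/
def stabilize (c : ℕ) : Prog α Bool := do
  recordCall
  let b ← lengthW
  stabilizeWhile c b
  partial_fixpoint

/-- The while loop of `Stabilize(c)`, entered with `unstable = true`. -/
def stabilizeWhile (c b : ℕ) : Prog α Bool := do
  tick
  if ← slowExtend c then
    pure true
  else
    let p ← palsAt c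
    match ← stabilizeFor c b (c + p) with
    | .returned => pure true
    | .broken => stabilizeWhile c b
    | .completed => pure false
  partial_fixpoint

/-- The for loop of `Stabilize(c)`, entered with the value `d` of its loop variable, which runs
downwards to `b`. -/
def stabilizeFor (c b d : ℕ) : Prog α ForExit := do
  tick
  if d < b then
    pure .completed
  else
    let p ← palsAt d
    let q ← palsAt c
    if c + q ≤ d + p then
      if ← fastExtend d then
        if ← stabilize d then
          let n ← lengthW
          if c = n then
            pure .returned
          else
            if d = n then
              let i ← sub (2 * c) d
              let v ← palsAt i
              setPals d v
            append
            pure .broken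
        else
          push d
          let d' ← sub d 1
          stabilizeFor c b d'
      else
        push d
        let d' ← sub d 1
        stabilizeFor c b d'
    else
      let d' ← sub d 1
      stabilizeFor c b d'
  partial_fixpoint

end

/-- The while loop of `ZReduce`. -/
def zReduceLoop : Prog α Unit := do
  tick
  if ← inputRemains then
    append
    clearStack
    let n ← lengthW
    let c ← sub n 1
    let _ ← stabilize c
    zReduceLoop
  else
    pure ()
  partial_fixpoint

/-- The body of `ZReduce(T)` after the sentinels have been added to the input.  The returned string
is `w[2:|w|-1]`. -/
def zReduceMain : Prog α (List (Letter α)) := do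
  append
  zReduceLoop
  let s ← get
  tick (s.w.length + 1)
  pure ((s.w.take (s.w.length - 1)).drop 1)

/-- The global variables before `ZReduce(T)` reads its first letter: the unread input is `$T#`,
which has been written down at a cost of one unit per letter. -/
def initialState (T : List α) : State α where
  unread := Letter.dollar :: (T.map Letter.letter ++ [Letter.hash])
  w := []
  pals := fun _ => none
  stack := []
  time := T.length + 2
  calls := 0
  pushes := 0
  pops := 0

/-- `ZReduce(T)`: the returned string and the final values of the global variables and counters;
`none` if the execution faults or does not terminate. -/
def zReduce (T : List α) : Option (List (Letter α) × State α) :=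
  zReduceMain.run (initialState T)

end Algorithm

end ZRed

/-!
# Linear-time computation of Z-normal forms

A factor `y yᴿ y` consists of two even palindromes whose centres, the folds of the factor, are
at distance `|y|` and whose radii are at least `|y|`.  All arguments are about the radii `Pal w i r`
of palindromes at the gaps `i` of a string, and they rest on reflections: a large palindrome maps
the palindromes inside it to palindromes (`Pal.reflect`).

*Uniqueness of the normal form* (`IsZNormalForm.unique`).  Consider the factor `y yᴿ y` of a string
that ends first.  Reflections show that another such factor overlaps it in a few configurations
only, and in each of them the two reducts have a common reduct (`FirstZ.joinable`).  By induction
on the length, every reduction leads to the normal form of this particular reduct.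

*Correctness.*  When `Stabilize(c)` is called, the working string without its last letter has no
factor `y yᴿ y`, and the palindrome at `c` reaches at least the last letter but one.  As long as the
palindrome at `c` grows, a new factor `y yᴿ y` at the end can only have `c` as its second fold
(`Z.fold_eq`), and then its first fold is the mirror image of the end, whose entry in `Pals` is
consulted.  That entry may be out of date because the gap has not been processed by an outer call,
but it is large enough to show that the palindrome reaches `c` (`Context`); gaps beyond a palindrome
that reaches `c` are never consulted, since there would be an earlier factor `y yᴿ y`.  When the
palindrome at `c` ends, the entries inside it that were copied from the mirror images are final,
except for the palindromes that reach its end; these are the ones that the for loop extends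
(`ForInv`).  The palindromes on the stack overlap from the end of the palindrome at `c` up to the
last letter (`Chain`), so they tell how far another palindrome extends (`fast_compare`).  A
call that returns true has cut off the working string at a gap which is the centre of the outer
call or one whose entry is an unchanged copy (`ForInv.cut`), so that the outer call can go on.

*Running time.*  Each value `d` of the variable of a for loop is paid for by the letter after the
gap `d`: it was read during the same call, and if the nested call `Stabilize(d)` returns true, then
this letter is deleted, so no letter pays twice.  Hence calls and pushes are at most as many as
letters read, and with a potential that also counts the letters of the working string and the
entries of the stack, the same accounting bounds the time (`Counts`).
-/

namespace ZRed

/-! ### Even palindromes -/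

section Palindromes

variable {β : Type*}

/-- `Pal w i r`: the `r` letters of `w` before the gap `i` (the gap after the first `i` letters)
are the reversal of the `r` letters after it.  In the condition, `a` and `b` run through the pairs
of positions, counted from `0`, that are mirror images of each other. -/
def Pal (w : List β) (i r : ℕ) : Prop :=
  r ≤ i ∧ i + r ≤ w.length ∧ ∀ a b, a + b + 1 = 2 * i → i ≤ b → b < i + r → w[a]? = w[b]?

/-- `p` is the radius of the maximal palindrome of `w` at the gap `i`, and this palindrome is
bounded by two different letters of `w`; it remains maximal in every extension of `w`. -/
def Closed (w : List β) (i p : ℕ) : Prop :=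
  Pal w i p ∧ p < i ∧ i + p < w.length ∧ w[i - p - 1]? ≠ w[i + p]?

/-- `Z w i r`: a factor `y yᴿ y` of `w` with `|y| = r` whose two folds are the gaps `i` and
`i + r`. -/
def Z (w : List β) (i r : ℕ) : Prop :=
  0 < r ∧ Pal w i r ∧ Pal w (i + r) r

/-- `w` contains no factor `y yᴿ y`. -/
def ZFree (w : List β) : Prop := ∀ i r, ¬ Z w i r

theorem Pal.mono {w : List β} {i r r' : ℕ} (h : Pal w i r) (hr : r' ≤ r) : Pal w i r' :=
  ⟨by have := h.1; omega, by have := h.2.1; omega,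
    fun a b hab h1 h2 => h.2.2 a b hab h1 (by omega)⟩

theorem pal_zero {w : List β} {i : ℕ} (h : i ≤ w.length) : Pal w i 0 :=
  ⟨by omega, by omega, fun a b _ _ _ => by omega⟩

/-- Two strings with a common prefix of length `n` have the same palindromes in it. -/
theorem Pal.congr {w w' : List β} {i r n : ℕ} (h : Pal w i r) (hn : i + r ≤ n)
    (hw : w.take n = w'.take n) (hl : n ≤ w'.length) : Pal w' i r := by
  have key : ∀ a, a < n → w[a]? = w'[a]? := fun a ha => by
    rw [← List.getElem?_take_of_lt ha, hw, List.getElem?_take_of_lt ha]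
  refine ⟨h.1, by omega, fun a b hab h1 h2 => ?_⟩
  rw [← key a (by omega), ← key b (by omega)]
  exact h.2.2 a b hab h1 h2

theorem Closed.congr {w w' : List β} {i p n : ℕ} (h : Closed w i p) (hn : i + p < n)
    (hw : w.take n = w'.take n) (hl : n ≤ w'.length) : Closed w' i p := by
  have key : ∀ a, a < n → w[a]? = w'[a]? := fun a ha => by
    rw [← List.getElem?_take_of_lt ha, hw, List.getElem?_take_of_lt ha]
  refine ⟨h.1.congr (by omega) hw hl, h.2.1, by omega, ?_⟩
  rw [← key _ (by omega), ← key _ (by omega)]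
  exact h.2.2.2

/-- Palindromes are mapped to palindromes by the reflection in a larger palindrome. -/
theorem Pal.reflect {w : List β} {c s i r j : ℕ} (hc : Pal w c s) (hi : Pal w i r)
    (hj : i + j = 2 * c) (h1 : i + r ≤ c + s) (h2 : c + r ≤ i + s) : Pal w j r := by
  obtain ⟨c1, c2, c3⟩ := hc
  obtain ⟨i1, i2, i3⟩ := hi
  have mir : ∀ a b, a + b + 1 = 2 * c → b < c + s → a < c + s → w[a]? = w[b]? := by
    intro a b hab hb ha
    rcases Nat.lt_or_ge b c with h | h
    · exact (c3 b a (by omega) (by omega) ha).symm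
    · exact c3 a b hab h hb
  refine ⟨by omega, by omega, fun a b hab hb1 hb2 => ?_⟩
  rw [mir a (2 * c - 1 - a) (by omega) (by omega) (by omega),
    mir b (2 * c - 1 - b) (by omega) (by omega) (by omega)]
  exact (i3 (2 * c - 1 - b) (2 * c - 1 - a) (by omega) (by omega) (by omega)).symm

theorem Closed.pal_le {w : List β} {i p r : ℕ} (h : Closed w i p) (hp : Pal w i r) : r ≤ p := by
  by_contra hlt
  obtain ⟨_, h1, h2, h3⟩ := h
  exact h3 (hp.2.2 _ _ (by omega) (by omega) (by omega))

theorem Pal.closed {w : List β} {i p : ℕ} (h : Pal w i p) (h1 : p < i) (h2 : i + p < w.length)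
    (h3 : w[i - p - 1]? ≠ w[i + p]?) : Closed w i p := ⟨h, h1, h2, h3⟩

theorem Pal.succ {w : List β} {i p : ℕ} (h : Pal w i p) (h1 : p < i) (h2 : i + p < w.length)
    (h3 : w[i - p - 1]? = w[i + p]?) : Pal w i (p + 1) := by
  refine ⟨by omega, by omega, fun a b hab hb1 hb2 => ?_⟩
  rcases Nat.lt_or_ge b (i + p) with h' | h'
  · exact h.2.2 a b hab hb1 h'
  · obtain rfl : b = i + p := by omega
    obtain rfl : a = i - p - 1 := by omega
    exact h3

/-- Maximal palindromes are mapped to maximal palindromes by the reflection in a larger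
palindrome, provided that the letters bounding them lie in the larger one, too. -/
theorem Closed.reflect {w : List β} {c s i p j : ℕ} (hc : Pal w c s) (hi : Closed w i p)
    (hj : i + j = 2 * c) (h1 : i + p < c + s) (h2 : c + p < i + s) : Closed w j p := by
  have hc' := hc
  obtain ⟨i0, i1, i2, i3⟩ := hi
  have hjp := hc.reflect i0 hj (by omega) (by omega)
  obtain ⟨c1, c2, c3⟩ := hc
  refine ⟨hjp, by omega, by omega, fun he => ?_⟩
  have := hc'.reflect (hjp.succ (by omega) (by omega) he) (j := i) (by omega) (by omega) (by omega)
  exact i3 (this.2.2 _ _ (by omega) (by omega) (by omega))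

/-- The reflection of a factor `y yᴿ y` in a palindrome. -/
theorem Z.reflect {w : List β} {c s i r j : ℕ} (hc : Pal w c s) (h : Z w i r)
    (hj : i + r + j = 2 * c) (h1 : i + 2 * r ≤ c + s) (h2 : c + r ≤ i + s) : Z w j r :=
  ⟨h.1, hc.reflect h.2.2 (by omega) (by omega) (by omega),
    hc.reflect h.2.1 (by omega) (by omega) (by omega)⟩

/-- If a string is `ZFree` up to its last letter and a gap `c` has a palindrome up to the end, then
the only factor `y yᴿ y` that the string can have is the one with second fold `c`: any other one
is mirrored to a factor that ends earlier. -/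
theorem Z.fold_eq {w : List β} {c n j r : ℕ} (hn : w.length = n + 1)
    (hfree : ZFree (w.take n)) (hc : Pal w c (n + 1 - c)) (hcn : c ≤ n)
    (hz : Z w j r) : j + r = c ∧ r = n + 1 - c := by
  have early : ∀ i t, Z w i t → i + 2 * t ≤ n → False := by
    rintro i t ⟨ht, h1, h2⟩ hit
    have e : w.take n = (w.take n).take n := by simp
    have hl : n ≤ (w.take n).length := by simp [hn]
    exact hfree i t ⟨ht, h1.congr (by omega) e hl, h2.congr (by omega) e hl⟩
  have hzz := hz
  obtain ⟨hr, h1, h2⟩ := hz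
  have b1 := h1.1
  have b2 := h2.2.1
  have b3 := hc.1
  have hend : j + 2 * r = n + 1 := by
    by_contra hne
    exact early j r hzz (by omega)
  rcases lt_trichotomy (j + r) c with h | h | h
  · exfalso
    refine early j (n + 1 - c) ⟨by omega, h1.mono (by omega), ?_⟩ (by omega)
    exact h2.reflect hc (by omega) (by omega) (by omega)
  · exact ⟨h, by omega⟩
  · exfalso
    rcases Nat.lt_or_ge j c with h' | h'
    · refine early c (j + r - c) ⟨by omega, hc.mono (by omega), ?_⟩ (by omega)
      rw [show c + (j + r - c) = j + r by omega]
      exact h2.mono (by omega)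
    · exact early (2 * c - (j + r)) r (hzz.reflect hc (by omega) (by omega) (by omega)) (by omega)

theorem pal_append (x y z : List β) :
    Pal (x ++ (y ++ (y.reverse ++ z))) (x.length + y.length) y.length := by
  refine ⟨by omega, by simp; omega, fun a b hab h1 h2 => ?_⟩
  rw [List.getElem?_append_right (by omega), List.getElem?_append_left (by omega),
    List.getElem?_append_right (by omega), List.getElem?_append_right (by omega),
    List.getElem?_append_left (by simp; omega), List.getElem?_reverse (by omega)]
  congr 1
  omega

theorem Pal.exists_append {w : List β} {i r : ℕ} (h : Pal w i r) :
    ∃ x y z, w = x ++ (y ++ (y.reverse ++ z)) ∧ x.length + r = i ∧ y.length = r := by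
  obtain ⟨h1, h2, h3⟩ := h
  refine ⟨w.take (i - r), (w.drop (i - r)).take r, w.drop (i + r), ?_, by simp; omega,
    by simp; omega⟩
  have e : ((w.drop (i - r)).take r).reverse = (w.drop i).take r := by
    apply List.ext_getElem?
    intro k
    rcases Nat.lt_or_ge k r with hk | hk
    · rw [List.getElem?_reverse (by simp; omega), List.getElem?_take_of_lt hk,
        List.getElem?_take_of_lt (by simp; omega), List.getElem?_drop, List.getElem?_drop]
      refine h3 _ _ ?_ (by omega) (by omega)
      simp only [List.length_take, List.length_drop]
      omega
    · rw [List.getElem?_eq_none (by simp; omega), List.getElem?_eq_none (by simp; omega)]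
  rw [e, show w.drop (i + r) = (w.drop i).drop r by simp, List.take_append_drop,
    show w.drop i = (w.drop (i - r)).drop r by simp; congr 1; omega,
    List.take_append_drop, List.take_append_drop]

end Palindromes

/-! ### Uniqueness of the normal form -/

section Confluence

variable {β : Type*}

open Relation

theorem append_split {a b c d : List β} (h : a ++ b = c ++ d) (hl : a.length ≤ c.length) :
    ∃ k, c = a ++ k ∧ b = k ++ d := by
  rcases List.append_eq_append_iff.1 h with ⟨k, h1, h2⟩ | ⟨k, h1, h2⟩
  · exact ⟨k, h1, h2⟩
  · have : k = [] := by
      have := congrArg List.length h1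
      simp at this
      exact List.eq_nil_of_length_eq_zero (by omega)
    subst this
    exact ⟨[], by simpa using h1.symm, by simpa using h2.symm⟩

theorem fold_reduces (x : List β) {y : List β} (z : List β) (hy : y ≠ []) :
    Reduces (x ++ (y ++ (y.reverse ++ (y ++ z)))) (x ++ (y ++ z)) :=
  ⟨x, y, z, hy, by simp, by simp⟩

theorem fold_reflTransGen (x y z : List β) :
    ReflTransGen Reduces (x ++ (y ++ (y.reverse ++ (y ++ z)))) (x ++ (y ++ z)) := by
  rcases eq_or_ne y [] with rfl | hy
  · simpa using ReflTransGen.refl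
  · exact ReflTransGen.single (fold_reduces x z hy)

theorem Reduces.length_lt {u v : List β} (h : Reduces u v) : v.length < u.length := by
  obtain ⟨x, y, z, hy, rfl, rfl⟩ := h
  have := List.length_pos_iff.2 hy
  simp
  omega

/-- A factor `y yᴿ y` as a decomposition of the string. -/
theorem Z.exists_append {w : List β} {i r : ℕ} (h : Z w i r) :
    ∃ x y z, w = x ++ (y ++ (y.reverse ++ (y ++ z))) ∧ x.length + r = i ∧ y.length = r ∧ y ≠ [] := by
  obtain ⟨hr, h1, h2⟩ := h
  obtain ⟨x, y, z, e, hx, hy⟩ := h1.exists_append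
  obtain ⟨x', y', z', e', hx', hy'⟩ := h2.exists_append
  have e2 : (x ++ y) ++ (y.reverse ++ z) = x' ++ (y' ++ (y'.reverse ++ z')) := by
    rw [← e', e]; simp
  obtain ⟨e3, e4⟩ := List.append_inj e2 (by simp; omega)
  obtain ⟨e5, e6⟩ := List.append_inj e4 (by simp; omega)
  refine ⟨x, y, z', ?_, hx, hy, by rintro rfl; simp at hy; omega⟩
  rw [e, e6, ← e5]
  simp

theorem z_append (x : List β) {y : List β} (z : List β) (hy : y ≠ []) :
    Z (x ++ (y ++ (y.reverse ++ (y ++ z)))) (x.length + y.length) y.length := by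
  refine ⟨List.length_pos_iff.2 hy, pal_append x y _, ?_⟩
  have := pal_append (x ++ y) y.reverse z
  simpa using this

theorem irreducible_of_zFree {w : List β} (h : ZFree w) : Irreducible w := by
  rintro ⟨v, x, y, z, hy, rfl, -⟩
  exact h (x.length + y.length) y.length (by simpa using z_append x z hy)

section Overlaps

variable (x y z k h p q v : List β)

/-- Two strings with a common reduct -/
def Joinable (u v : List β) : Prop := Join (ReflTransGen Reduces) u v

/-- The factor `y yᴿ y` lies inside the first third of the factor `Y Yᴿ Y`. -/
theorem joinable_inside :
    let Y := p ++ (y ++ (y.reverse ++ (y ++ q)))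
    Joinable (x ++ (p ++ (y ++ (q ++ (Y.reverse ++ (Y ++ z)))))) (x ++ (Y ++ z)) := by
  intro Y
  refine ⟨x ++ (p ++ (y ++ (q ++ z))), ?_, ?_⟩
  · have e1 := fold_reflTransGen (x ++ (p ++ (y ++ (q ++ Y.reverse))) ++ p) y (q ++ z)
    have e2 := fold_reflTransGen (x ++ (p ++ (y ++ (q ++ q.reverse)))) y.reverse
      (p.reverse ++ (p ++ (y ++ (q ++ z))))
    have e3 := fold_reflTransGen x (p ++ (y ++ q)) z
    simp [Y] at e1 e2 e3 ⊢
    exact e1.trans (e2.trans e3)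
  · have e1 := fold_reflTransGen (x ++ p) y (q ++ z)
    simp [Y] at e1 ⊢
    exact e1

/-- The factors `y yᴿ y` and `q qᴿ q` do not overlap. -/
theorem joinable_disjoint :
    Joinable (x ++ (y ++ (k ++ (q ++ (q.reverse ++ (q ++ z))))))
      (x ++ (y ++ (y.reverse ++ (y ++ (k ++ (q ++ z)))))) := by
  refine ⟨x ++ (y ++ (k ++ (q ++ z))), ?_, fold_reflTransGen x y _⟩
  simpa using fold_reflTransGen (x ++ (y ++ k)) q z

/-- The factor `Y Yᴿ Y` starts in the last third of the factor `y yᴿ y` and has its first fold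
after the end of this factor. -/
theorem joinable_overlap_short :
    let y := k ++ h
    let Y := h ++ q
    Joinable (x ++ (y ++ (q ++ (Y.reverse ++ (Y ++ z)))))
      (x ++ (y ++ (y.reverse ++ (k ++ (Y ++ z))))) := by
  intro y Y
  refine ⟨x ++ (k ++ (h ++ (q ++ z))), ?_, ?_⟩
  · simpa [y, Y] using fold_reflTransGen (x ++ k) (h ++ q) z
  · simpa [y, Y] using fold_reflTransGen x (k ++ h) (q ++ z)

/-- The factor `Y Yᴿ Y` starts in the second third of the factor `y yᴿ y` and has its first fold
after the end of this factor. -/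
theorem joinable_overlap_second (hq : y.reverse = h ++ q) :
    let Y := q ++ (y ++ v)
    Joinable (x ++ (y ++ (v ++ (Y.reverse ++ (Y ++ z))))) (x ++ (y ++ (h ++ (Y ++ z)))) := by
  intro Y
  have hy : y = q.reverse ++ h.reverse := by
    rw [← List.reverse_append, ← hq, List.reverse_reverse]
  refine ⟨x ++ (y ++ (v ++ z)), ?_, ?_⟩
  · have e1 := fold_reflTransGen (x ++ (y ++ (v ++ (v.reverse ++ h)))) q (y ++ (v ++ z))
    have e2 := fold_reflTransGen x (y ++ v) z
    simp only [Y, List.reverse_append, List.append_assoc, hq] at e1 e2 ⊢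
    exact e1.trans e2
  · have e1 := fold_reflTransGen x y (v ++ z)
    simp only [Y, hq, List.append_assoc] at e1 ⊢
    exact e1

/-- The factor `Y Yᴿ Y` starts in the first third of the factor `y yᴿ y` and has its first fold
after the end of this factor. -/
theorem joinable_overlap_first (hy : y = k ++ h) :
    let Y := h ++ (y.reverse ++ (y ++ v))
    Joinable (x ++ (y ++ (v ++ (Y.reverse ++ (Y ++ z))))) (x ++ (k ++ (Y ++ z))) := by
  intro Y
  refine ⟨x ++ (y ++ (v ++ z)), ?_, ?_⟩
  · have e1 := fold_reflTransGen (x ++ (y ++ (v ++ (v.reverse ++ (y.reverse ++ k))))) h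
      (y.reverse ++ (y ++ (v ++ z)))
    have e2 := fold_reflTransGen (x ++ (y ++ (v ++ v.reverse))) y.reverse (y ++ (v ++ z))
    have e3 := fold_reflTransGen x (y ++ v) z
    have e4 : (x ++ (y ++ (v ++ (Y.reverse ++ (Y ++ z))))) =
      (x ++ (y ++ (v ++ (v.reverse ++ (y.reverse ++ k))))) ++ (h ++ (h.reverse ++ (h ++
        (y.reverse ++ (y ++ (v ++ z)))))) := by
      simp only [Y, List.reverse_append, List.append_assoc, List.reverse_reverse]
      nth_rewrite 3 [hy]
      simp
    have e5 : (x ++ (y ++ (v ++ (v.reverse ++ (y.reverse ++ k))))) ++ (h ++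
        (y.reverse ++ (y ++ (v ++ z)))) = (x ++ (y ++ (v ++ v.reverse))) ++ (y.reverse ++
        (y.reverse.reverse ++ (y.reverse ++ (y ++ (v ++ z))))) := by
      rw [List.reverse_reverse]
      simp only [List.append_assoc]
      rw [← List.append_assoc k h, ← hy]
    rw [e4]
    refine e1.trans ?_
    rw [e5]
    refine e2.trans ?_
    simpa using e3
  · have e1 := fold_reflTransGen x y (v ++ z)
    have e4 : x ++ (k ++ (Y ++ z)) = x ++ (y ++ (y.reverse ++ (y ++ (v ++ z)))) := by
      conv_rhs => rw [hy]
      simp [Y, hy]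
    rw [e4]
    exact e1

/-- The second fold of `y yᴿ y` is the first fold of `Y Yᴿ Y`, and `Y` is at least twice as long
as `y`. -/
theorem joinable_fold_long :
    let Y := p ++ (y ++ y.reverse)
    Joinable (x ++ (p ++ (Y.reverse ++ (Y ++ z)))) (x ++ (Y ++ z)) := by
  intro Y
  refine ⟨x ++ (Y ++ z), ?_, ReflTransGen.refl⟩
  simpa [Y] using fold_reflTransGen x (p ++ y) (y.reverse ++ z)

/-- The second fold of `y yᴿ y` is the first fold of `Y Yᴿ Y`, and `Y` is less than twice as long
as `y`. -/
theorem joinable_fold_short :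
    let y := k ++ h
    let Y := h ++ y.reverse
    Joinable (x ++ (y ++ (h.reverse ++ (Y ++ z)))) (x ++ (k ++ (Y ++ z))) := by
  intro y Y
  refine ⟨x ++ (k ++ (Y ++ z)), ?_, ReflTransGen.refl⟩
  simpa [y, Y] using fold_reflTransGen (x ++ k) h (y.reverse ++ z)

/-- The factors `y yᴿ y` and `Y Yᴿ Y` have the same second fold, and `Y` is at least twice as long
as `y`. -/
theorem joinable_fold_second :
    let Y := y ++ (y.reverse ++ q)
    Joinable (x ++ (Y ++ (q.reverse ++ (y ++ (y.reverse ++ (q ++ z)))))) (x ++ (Y ++ z)) := by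
  intro Y
  refine ⟨x ++ (Y ++ z), ?_, ReflTransGen.refl⟩
  simpa [Y] using fold_reflTransGen (x ++ y) (y.reverse ++ q) z

end Overlaps

/-- `Z w c r` ends first among the factors `y yᴿ y` of `w`, and is the shortest one among those
that end there. -/
structure FirstZ (w : List β) (c r : ℕ) : Prop where
  z : Z w c r
  le : ∀ d t, Z w d t → c + 2 * r ≤ d + 2 * t
  short : ∀ d t, Z w d t → c + 2 * r = d + 2 * t → r ≤ t

theorem exists_firstZ {w : List β} (h : ¬ ZFree w) : ∃ c r, FirstZ w c r := by
  classical
  have h1 : ∃ n d t, Z w d t ∧ d + 2 * t = n := by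
    simp only [ZFree, not_forall, not_not] at h
    obtain ⟨d, t, h⟩ := h
    exact ⟨_, d, t, h, rfl⟩
  have h2 : ∃ t d, Z w d t ∧ d + 2 * t = Nat.find h1 := by
    obtain ⟨d, t, h⟩ := Nat.find_spec h1
    exact ⟨t, d, h⟩
  obtain ⟨c, hc, e⟩ := Nat.find_spec h2
  refine ⟨c, Nat.find h2, hc, fun d t hz => ?_, fun d t hz e' => ?_⟩
  · rw [e]
    exact Nat.find_min' h1 ⟨d, t, hz, rfl⟩
  · exact Nat.find_min' h2 ⟨d, hz, by omega⟩

/-- A gap `e` strictly between the second fold and the end of the first factor `y yᴿ y` is not the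
centre of a palindrome reaching the end of this factor: mirrored at the second fold, it would give
rise to an earlier factor. -/
theorem FirstZ.not_pal {w : List β} {c r e : ℕ} (h : FirstZ w c r) (h1 : c + r < e)
    (h2 : e < c + 2 * r) (hp : Pal w e (c + 2 * r - e)) : False := by
  have hz := h.z
  have hq := hz.2.2.reflect hp (j := 2 * (c + r) - e) (by omega) (by omega) (by omega)
  have := h.le c (c + 2 * r - e) ⟨by omega, hz.2.1.mono (by omega), by
    rwa [show c + (c + 2 * r - e) = 2 * (c + r) - e by omega]⟩
  omega

/-- A gap `e` before the second fold of the first factor `y yᴿ y` is not the centre of a palindrome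
reaching the end of this factor: either the whole factor is mirrored at `e` to an earlier one, or
`e` and the second fold are the folds of an earlier one. -/
theorem FirstZ.not_pal_before {w : List β} {c r e t : ℕ} (h : FirstZ w c r) (he : e + t ≥ c + 2 * r)
    (h1 : e < c + r) (hp : Pal w e t) : False := by
  have hz := h.z
  rcases Nat.lt_or_ge (2 * e) (2 * c + r) with h2 | h2
  · have b1 := hp.1
    have b2 := hz.2.1.1
    have := h.le (2 * e - (c + r)) r (hz.reflect hp (by omega) (by omega) (by omega))
    omega
  · have := h.le e (c + r - e) ⟨by omega, hp.mono (by omega), by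
      rw [show e + (c + r - e) = c + r by omega]; exact hz.2.2.mono (by omega)⟩
    have := hz.1
    omega

/-- Any two reductions, one of them at the factor which ends first, have a common reduct.  The cases
are distinguished by the positions of the folds of the other factor relative to the first one. -/
theorem FirstZ.joinable {w x y s x' Y s' : List β}
    (e : w = x ++ (y ++ (y.reverse ++ (y ++ s)))) (e' : w = x' ++ (Y ++ (Y.reverse ++ (Y ++ s'))))
    (hY : Y ≠ []) (h : FirstZ w (x.length + y.length) y.length) :
    Joinable (x ++ (y ++ s)) (x' ++ (Y ++ s')) := by
  have hz := h.z
  have hz' : Z w (x'.length + Y.length) Y.length := e' ▸ z_append x' s' hY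
  have hend := h.le _ _ hz'
  have hshort := h.short _ _ hz'
  have hr := hz.1
  have ht := hz'.1
  have p1 := hz'.2.1
  have p2 := hz'.2.2
  have ee := e.symm.trans e'
  rcases Nat.lt_or_ge (x'.length + Y.length) (x.length + 3 * y.length) with c1 | c1
  · rcases Nat.lt_or_ge (x'.length + 2 * Y.length) (x.length + 3 * y.length) with c2 | c2
    · -- both folds of the second factor lie before the end of the first one
      rcases lt_trichotomy (x'.length + 2 * Y.length) (x.length + 2 * y.length) with c3 | c3 | c3
      · exact (h.not_pal_before (by omega) (by omega) p2).elim
      · rcases Nat.lt_or_ge x.length (x'.length + Y.length) with c4 | c4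
        · -- if the first folds differ, then they are the folds of an earlier factor
          rcases Nat.lt_or_ge (x'.length + Y.length) (x.length + y.length) with c5 | c5
          · have := h.le (x'.length + Y.length) (x.length + y.length - (x'.length + Y.length))
              ⟨by omega, p1.mono (by omega), by
                rw [show x'.length + Y.length + (x.length + y.length - (x'.length + Y.length))
                  = x.length + y.length by omega]
                exact hz.2.1.mono (by omega)⟩
            omega
          · have e1 : x.length = x'.length := by omega
            obtain ⟨e2, e3⟩ := List.append_inj ee e1
            obtain ⟨e4, e5⟩ := List.append_inj e3 (by omega)
            subst e2 e4
            have : s = s' := by simpa using e5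
            subst this
            exact ⟨_, ReflTransGen.refl, ReflTransGen.refl⟩
        · -- the common second fold
          have e1 : (x ++ (y ++ y.reverse)) ++ (y ++ s) = (x' ++ (Y ++ Y.reverse)) ++ (Y ++ s') := by
            simpa using ee
          obtain ⟨e2, e3⟩ := List.append_inj e1 (by simp; omega)
          obtain ⟨k, e4, e5⟩ := append_split e3 (by omega)
          have e6 := congrArg List.reverse e2
          simp only [List.reverse_append, List.reverse_reverse, List.append_assoc] at e6
          obtain ⟨k', e7, e8⟩ := append_split (a := y ++ y.reverse) (b := x.reverse) (c := Y)
            (by simpa using e6) (by simp; omega)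
          have e9 : x = x' ++ (Y ++ k'.reverse) := by
            have := congrArg List.reverse e8
            simpa using this
          rw [e9, e5, e7]
          have := joinable_fold_second x' y s' k'
          simp only [e4] at *
          have e10 : y.reverse ++ k' = k := by
            rw [List.append_assoc] at e7
            exact (List.append_cancel_left e7).symm
          subst e10
          simpa using this
      · exact (h.not_pal (e := x'.length + 2 * Y.length) (by omega) (by omega)
          ((by rwa [two_mul, ← add_assoc] : Pal w (x'.length + 2 * Y.length) Y.length).mono
            (by omega))).elim
    · rcases lt_trichotomy (x'.length + Y.length) (x.length + 2 * y.length) with c3 | c3 | c3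
      · exact (h.not_pal_before (by omega) (by omega) p1).elim
      · -- the second fold of the first factor is the first fold of the second one
        have e1 : (x ++ (y ++ y.reverse)) ++ (y ++ s) = (x' ++ Y) ++ (Y.reverse ++ (Y ++ s')) := by
          simpa using ee
        obtain ⟨e2, e3⟩ := List.append_inj e1 (by simp; omega)
        obtain ⟨k, e4, e5⟩ := append_split e3 (by simp; omega)
        have e6 : Y = k.reverse ++ y.reverse := by
          rw [← List.reverse_append, ← e4, List.reverse_reverse]
        rcases Nat.lt_or_ge Y.length (2 * y.length) with c4 | c4
        · have e7 : x ++ y = x' ++ k.reverse := by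
            rw [e6] at e2
            simpa [← List.append_assoc] using e2
          have e6' := congrArg List.length e6
          simp at e6'
          obtain ⟨m, e8, e9⟩ := append_split e7.symm.symm (by
            have := congrArg List.length e7
            simp at this ⊢
            omega)
          have e10 : y.reverse = k ++ m.reverse := by rw [e9]; simp
          have := joinable_fold_short x s' m k.reverse
          simp only [← e9, ← e6] at this
          rw [e5, e8]
          simpa using this
        · have e2' := congrArg List.reverse e2
          obtain ⟨m, e8, e9⟩ := append_split (a := y ++ y.reverse) (b := x.reverse)
            (c := Y.reverse) (d := x'.reverse) (by simpa using e2') (by simp; omega)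
          have e10 : Y = m.reverse ++ (y ++ y.reverse) := by
            have := congrArg List.reverse e8
            simpa using this
          have e11 : x = x' ++ m.reverse := by
            have := congrArg List.reverse e9
            simpa using this
          have := joinable_fold_long x' y s' m.reverse
          simp only [← e10] at this
          rw [e11, e5]
          rw [e4] at this
          simpa using this
      · exact (h.not_pal (e := x'.length + Y.length) (by omega) (by omega)
          (p1.mono (by omega))).elim
  · -- the first factor ends before the first fold of the second one
    rcases Nat.lt_or_ge x.length x'.length with c2 | c2
    · -- the first factor is disjoint from the second one, or overlaps its first third partially
      rcases Nat.lt_or_ge x'.length (x.length + 3 * y.length) with c3 | c3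
      · obtain ⟨a, e1, e2⟩ := append_split ee (by omega)
        have e1' := congrArg List.length e1
        simp at e1'
        rcases Nat.lt_or_ge x'.length (x.length + y.length) with c4 | c4
        · obtain ⟨b, e3, e4⟩ := append_split e2.symm (by omega)
          obtain ⟨v, e5, e6⟩ := append_split (a := b ++ (y.reverse ++ y)) (b := s) (c := Y)
            (by simpa using e4.symm) (by
              have := congrArg List.length e3
              simp at this ⊢
              omega)
          have := joinable_overlap_first x y s' a b v e3
          have e7 : Y = b ++ (y.reverse ++ (y ++ v)) := by simpa using e5
          rw [← e7] at this
          rw [e1, e6]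
          simpa using this
        · obtain ⟨a', e3, e4⟩ := append_split e2 (by omega)
          rcases Nat.lt_or_ge x'.length (x.length + 2 * y.length) with c5 | c5
          · have e3' := congrArg List.length e3
            simp at e3'
            obtain ⟨b, e5, e6⟩ := append_split e4.symm (by simp; omega)
            have e5' := congrArg List.length e5
            simp at e5'
            obtain ⟨v, e7, e8⟩ := append_split (a := b ++ y) (b := s) (c := Y)
              (by simpa using e6.symm) (by simp; omega)
            have e9 : Y = b ++ (y ++ v) := by simpa using e7
            have := joinable_overlap_second x y s' a' b v e5
            simp only [← e9] at this
            rw [e1, e3, e8]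
            simpa using this
          · have e3' := congrArg List.length e3
            simp at e3'
            obtain ⟨a'', e5, e6⟩ := append_split e4 (by simp; omega)
            have e5' := congrArg List.length e5
            simp at e5'
            obtain ⟨b, e7, e8⟩ := append_split e6.symm (by omega)
            have e7' := congrArg List.length e7
            simp at e7'
            obtain ⟨v, e9, e10⟩ := append_split e8.symm (by omega)
            have := joinable_overlap_short x s' a'' b v
            simp only [← e9, ← e7] at this
            rw [e1, e3, e5, e10]
            simpa using this
      · obtain ⟨k, e1, e2⟩ := append_split (a := x ++ (y ++ (y.reverse ++ y))) (b := s)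
          (by simpa using ee) (by simp; omega)
        rw [e1, e2]
        simpa using joinable_disjoint x y s' k Y
    · -- the first factor lies inside the first third of the second one
      obtain ⟨p, e1, e2⟩ := append_split ee.symm (by omega)
      have e1' := congrArg List.length e1
      simp at e1'
      obtain ⟨q, e3, e4⟩ := append_split (a := p ++ (y ++ (y.reverse ++ y))) (b := s) (c := Y)
        (by simpa using e2.symm) (by simp; omega)
      have e5 : Y = p ++ (y ++ (y.reverse ++ (y ++ q))) := by simpa using e3
      have := joinable_inside x' y s' p q
      simp only [← e5] at this
      rw [e1, e4]
      simpa using this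

theorem exists_isZNormalForm (w : List β) : ∃ u, IsZNormalForm w u := by
  induction hn : w.length using Nat.strong_induction_on generalizing w with
  | _ n ih =>
    by_cases h : Irreducible w
    · exact ⟨w, ReflTransGen.refl, h⟩
    · obtain ⟨v, hv⟩ := not_not.1 h
      obtain ⟨u, h1, h2⟩ := ih _ (hn ▸ hv.length_lt) v rfl
      exact ⟨u, ReflTransGen.head hv h1, h2⟩

/-- A string has only one normal form: by induction on the length of the string, since every
reduction is joinable with the one at the first factor `y yᴿ y`. -/
theorem IsZNormalForm.unique {w u v : List β} (hu : IsZNormalForm w u) (hv : IsZNormalForm w v) :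
    u = v := by
  induction hn : w.length using Nat.strong_induction_on generalizing w u v with
  | _ n ih =>
    subst hn
    by_cases hw : ZFree w
    · have key : ∀ {t}, IsZNormalForm w t → w = t := fun {t} ht => by
        rcases ht.1.cases_head with h | ⟨b, h, -⟩
        · exact h
        · exact (irreducible_of_zFree hw ⟨b, h⟩).elim
      rw [← key hu, ← key hv]
    · obtain ⟨c, r, hf⟩ := exists_firstZ hw
      obtain ⟨x, y, s, e, hx, rfl, hy⟩ := hf.z.exists_append
      have ha : Reduces w (x ++ (y ++ s)) := e ▸ fold_reduces x s hy
      have key : ∀ {t}, IsZNormalForm w t → IsZNormalForm (x ++ (y ++ s)) t := fun {t} ht => by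
        rcases ht.1.cases_head with rfl | ⟨b, h, hbt⟩
        · exact (ht.2 ⟨_, ha⟩).elim
        · have hb := h.length_lt
          obtain ⟨x', Y, s', hY, e', rfl⟩ := h
          obtain ⟨m, hm1, hm2⟩ := FirstZ.joinable (x' := x') (Y := Y) (s' := s') e
            (by simpa using e') hY (hx ▸ hf)
          obtain ⟨m', hm', hi⟩ := exists_isZNormalForm m
          have : t = m' := ih _ hb ⟨hbt, ht.2⟩ ⟨by simpa using hm2.trans hm', hi⟩ rfl
          exact ⟨this ▸ hm1.trans hm', ht.2⟩
      exact ih _ ha.length_lt (key hu) (key hv) rfl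

end Confluence

/-! ### Executions of programs -/

section Executions

variable {α : Type} {β γ : Type}

/-- The program `m` started in the state `s` terminates without a fault, and its result and the
final state satisfy `Q`. -/
def Ok (m : Prog α β) (s : State α) (Q : β → State α → Prop) : Prop :=
  ∃ r s', m s = some (r, s') ∧ Q r s'

theorem Ok.mono {m : Prog α β} {s : State α} {Q Q' : β → State α → Prop} (h : Ok m s Q)
    (hQ : ∀ r s', Q r s' → Q' r s') : Ok m s Q' := by
  obtain ⟨r, s', h1, h2⟩ := h
  exact ⟨r, s', h1, hQ _ _ h2⟩

theorem ok_bind {m : Prog α β} {f : β → Prog α γ} {s : State α} {Q : γ → State α → Prop} :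
    Ok (m >>= f) s Q ↔ Ok m s fun r s' => Ok (f r) s' Q := by
  constructor
  · rintro ⟨r, s', h, hQ⟩
    obtain ⟨⟨r1, s1⟩, h1, h2⟩ := Option.bind_eq_some_iff.1 (h : (m s).bind _ = _)
    exact ⟨r1, s1, h1, r, s', h2, hQ⟩
  · rintro ⟨r1, s1, h1, r, s', h2, hQ⟩
    exact ⟨r, s', Option.bind_eq_some_iff.2 ⟨_, h1, h2⟩, hQ⟩

theorem ok_pure {a : β} {s : State α} {Q : β → State α → Prop} :
    Ok (pure a : Prog α β) s Q ↔ Q a s := by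
  constructor
  · rintro ⟨r, s', h, hQ⟩
    obtain ⟨rfl, rfl⟩ := Prod.mk.inj (Option.some.inj (h : some (a, s) = _))
    exact hQ
  · exact fun h => ⟨a, s, rfl, h⟩

theorem ok_get {s : State α} {Q : State α → State α → Prop} :
    Ok (get : Prog α (State α)) s Q ↔ Q s s := ok_pure (a := s)

theorem ok_set {s t : State α} {Q : PUnit → State α → Prop} :
    Ok (set t : Prog α PUnit) s Q ↔ Q ⟨⟩ t := by
  constructor
  · rintro ⟨r, s', h, hQ⟩
    obtain ⟨rfl, rfl⟩ := Prod.mk.inj (Option.some.inj (h : some (PUnit.unit, t) = _))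
    exact hQ
  · exact fun h => ⟨_, _, rfl, h⟩

theorem ok_modify {s : State α} {f : State α → State α} {Q : PUnit → State α → Prop} :
    Ok (modify f : Prog α PUnit) s Q ↔ Q ⟨⟩ (f s) := by
  constructor
  · rintro ⟨r, s', h, hQ⟩
    obtain ⟨rfl, rfl⟩ := Prod.mk.inj (Option.some.inj (h : some (PUnit.unit, f s) = _))
    exact hQ
  · exact fun h => ⟨_, _, rfl, h⟩

theorem ok_tick {k : ℕ} {s : State α} {Q : Unit → State α → Prop} :
    Ok (tick k) s Q ↔ Q () { s with time := s.time + k } := by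
  constructor
  · rintro ⟨r, s', h, hQ⟩
    obtain ⟨rfl, rfl⟩ := Prod.mk.inj (Option.some.inj h)
    exact hQ
  · exact fun h => ⟨_, _, rfl, h⟩

theorem not_ok_failure {s : State α} {Q : β → State α → Prop} :
    ¬ Ok (failure : Prog α β) s Q := by
  rintro ⟨r, s', h, -⟩
  exact nomatch (h : none = _)

theorem ok_sub {a b : ℕ} {s : State α} {Q : ℕ → State α → Prop} :
    Ok (sub a b) s Q ↔ b ≤ a ∧ Q (a - b) { s with time := s.time + 1 } := by
  simp only [sub, ok_bind, ok_tick]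
  split <;> simp [ok_pure, not_ok_failure, *]

theorem ok_inputRemains {s : State α} {Q : Bool → State α → Prop} :
    Ok inputRemains s Q ↔ Q (!s.unread.isEmpty) { s with time := s.time + 1 } := by
  simp only [inputRemains, ok_bind, ok_tick, ok_get, ok_pure]

theorem ok_append {s : State α} {Q : Unit → State α → Prop} :
    Ok append s Q ↔ ∃ t rest, s.unread = t :: rest ∧
      Q () { s with time := s.time + 1, unread := rest, w := s.w ++ [t] } := by
  simp only [append, ok_bind, ok_tick, ok_get]
  split <;> simp_all [ok_set, not_ok_failure]

theorem ok_lengthW {s : State α} {Q : ℕ → State α → Prop} :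
    Ok lengthW s Q ↔ Q s.w.length { s with time := s.time + 1 } := by
  simp only [lengthW, ok_bind, ok_tick, ok_get, ok_pure]

theorem ok_letterAt {i : ℕ} {s : State α} {Q : Letter α → State α → Prop} :
    Ok (letterAt i) s Q ↔ 1 ≤ i ∧ ∃ a, s.w[i - 1]? = some a ∧
      Q a { s with time := s.time + 1 } := by
  simp only [letterAt, ok_bind, ok_tick, ok_get]
  split
  · split <;> simp_all [ok_pure, not_ok_failure]
  · simp_all [not_ok_failure]

theorem ok_palsAt {i : ℕ} {s : State α} {Q : ℕ → State α → Prop} :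
    Ok (palsAt i) s Q ↔ ∃ v, s.pals i = some v ∧ Q v { s with time := s.time + 1 } := by
  simp only [palsAt, ok_bind, ok_tick, ok_get]
  split <;> simp_all [ok_pure, not_ok_failure]

theorem ok_setPals {i v : ℕ} {s : State α} {Q : Unit → State α → Prop} :
    Ok (setPals i v) s Q ↔ (1 ≤ i ∧ i ≤ s.w.length ∧ v ≤ s.w.length) ∧
      Q () { s with time := s.time + 1, pals := Function.update s.pals i (some v) } := by
  simp only [setPals, ok_bind, ok_tick, ok_get]
  split <;> simp_all [ok_set, not_ok_failure]

theorem ok_truncate {k : ℕ} {s : State α} {Q : Unit → State α → Prop} :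
    Ok (truncate k) s Q ↔ k ≤ s.w.length ∧
      Q () { s with
        time := s.time + (s.w.length - k + 1)
        w := s.w.take k
        pals := fun i => if i ≤ k then s.pals i else none } := by
  simp only [truncate, ok_bind, ok_tick, ok_get]
  split <;> simp_all [ok_set, not_ok_failure]

theorem ok_stackIsEmpty {s : State α} {Q : Bool → State α → Prop} :
    Ok stackIsEmpty s Q ↔ Q s.stack.isEmpty { s with time := s.time + 1 } := by
  simp only [stackIsEmpty, ok_bind, ok_tick, ok_get, ok_pure]

theorem ok_top {s : State α} {Q : ℕ → State α → Prop} :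
    Ok top s Q ↔ ∃ d rest, s.stack = d :: rest ∧ Q d { s with time := s.time + 1 } := by
  simp only [top, ok_bind, ok_tick, ok_get]
  split <;> simp_all [ok_pure, not_ok_failure]

theorem ok_push {d : ℕ} {s : State α} {Q : Unit → State α → Prop} :
    Ok (push d) s Q ↔
      Q () { s with time := s.time + 1, stack := d :: s.stack, pushes := s.pushes + 1 } := by
  simp only [push, ok_bind, ok_tick, ok_modify]

theorem ok_pop {s : State α} {Q : Unit → State α → Prop} :
    Ok pop s Q ↔ ∃ d rest, s.stack = d :: rest ∧
      Q () { s with time := s.time + 1, stack := rest, pops := s.pops + 1 } := by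
  simp only [pop, ok_bind, ok_tick, ok_get]
  split <;> simp_all [ok_set, not_ok_failure]

theorem ok_clearStack {s : State α} {Q : Unit → State α → Prop} :
    Ok clearStack s Q ↔ Q () { s with time := s.time + (s.stack.length + 1), stack := [] } := by
  simp only [clearStack, ok_bind, ok_tick, ok_get, ok_modify]

theorem ok_recordCall {s : State α} {Q : Unit → State α → Prop} :
    Ok recordCall s Q ↔ Q () { s with time := s.time + 1, calls := s.calls + 1 } := by
  simp only [recordCall, ok_bind, ok_tick, ok_modify]

end Executions

/-! ### The working string and the unread input -/

section Input

variable {α : Type}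

open Relation

theorem letter_injective : Function.Injective (Letter.letter : α → Letter α) :=
  fun _ _ h => Letter.letter.inj h

theorem map_letter_reduces {m : List α} {x y z : List (Letter α)} (hy : y ≠ [])
    (h : m.map Letter.letter = x ++ (y ++ (y.reverse ++ (y ++ z)))) :
    ∃ m', Reduces m m' ∧ m'.map Letter.letter = x ++ (y ++ z) := by
  obtain ⟨x', m1, rfl, rfl, h1⟩ := List.map_eq_append_iff.1 h
  obtain ⟨y', m2, rfl, rfl, h2⟩ := List.map_eq_append_iff.1 h1
  obtain ⟨y2, m3, rfl, e, h3⟩ := List.map_eq_append_iff.1 h2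
  obtain ⟨y3, z', rfl, e', rfl⟩ := List.map_eq_append_iff.1 h3
  obtain rfl : y2 = y'.reverse := List.map_injective_iff.2 letter_injective (by simpa using e)
  obtain rfl : y3 = y' := List.map_injective_iff.2 letter_injective (by simpa using e')
  exact ⟨x' ++ (y3 ++ z'), fold_reduces x' z' (by simpa using hy), by simp⟩

theorem notMem_hash (m : List α) : Letter.hash ∉ m.map Letter.letter := by simp

theorem notMem_dollar (m : List α) : Letter.dollar ∉ m.map Letter.letter := by simp

/-- A sentinel letter occurs only once, so it does not belong to a factor `y yᴿ y`. -/
theorem sentinel_reduces {m : List α} {x y z : List (Letter α)} (hy : y ≠ [])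
    (h : Letter.dollar :: (m.map Letter.letter ++ [Letter.hash]) =
      x ++ (y ++ (y.reverse ++ (y ++ z)))) :
    ∃ m', Reduces m m' ∧
      Letter.dollar :: (m'.map Letter.letter ++ [Letter.hash]) = x ++ (y ++ z) := by
  classical
  have once : ∀ a ∈ y, 3 ≤ List.count a
      (Letter.dollar :: (m.map Letter.letter ++ [Letter.hash])) := by
    intro a ha
    have := List.count_pos_iff.2 ha
    rw [h]
    simp only [List.count_append, List.count_reverse]
    omega
  have hd : Letter.dollar ∉ y := fun hm => by
    have h3 := once _ hm
    have := List.count_eq_zero.2 (notMem_dollar m)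
    simp [this] at h3
  have hh : Letter.hash ∉ y := fun hm => by
    have h3 := once _ hm
    have := List.count_eq_zero.2 (notMem_hash m)
    simp [this] at h3
  obtain ⟨a, y', rfl⟩ := List.exists_cons_of_ne_nil hy
  rcases x with _ | ⟨b, x⟩
  · simp only [List.nil_append, List.cons_append, List.cons.injEq] at h
    exact (hd (by simp [← h.1])).elim
  · simp only [List.cons_append, List.cons.injEq] at h
    obtain ⟨rfl, h⟩ := h
    rcases List.eq_nil_or_concat z with rfl | ⟨z, c, rfl⟩
    · have := congrArg List.reverse h
      simp only [List.append_nil, List.reverse_append, List.reverse_cons, List.reverse_nil,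
        List.nil_append, List.cons_append] at this
      refine (hh ?_).elim
      have h2 : Letter.hash ∈ List.reverse (a :: y') := by
        rcases e : (a :: y').reverse with _ | ⟨d, l⟩
        · simp at e
        · simp only [List.reverse_cons] at e
          simp [e] at this
          simp [this.1]
      exact List.mem_reverse.1 h2
    · have h1 : m.map Letter.letter ++ [Letter.hash] =
          (x ++ ((a :: y') ++ ((a :: y').reverse ++ ((a :: y') ++ z)))) ++ [c] := by
        rw [h]; simp
      obtain ⟨h2, h3⟩ := List.append_inj' h1 rfl
      obtain ⟨m', hm, e⟩ := map_letter_reduces (by simp) h2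
      refine ⟨m', hm, ?_⟩
      rw [e, h3]
      simp

/-- The working string `w` and the unread input `u` together form the input with sentinels, up to
reductions of the original input `T`. -/
def Input (T : List α) (u w : List (Letter α)) : Prop :=
  w ≠ [] ∧ ∃ m : List α, w ++ u = Letter.dollar :: (m.map Letter.letter ++ [Letter.hash]) ∧
    ReflTransGen Reduces T m

variable {T : List α} {u w : List (Letter α)}

theorem Input.append {t : Letter α} (h : Input T (t :: u) w) : Input T u (w ++ [t]) :=
  ⟨by simp, by simpa using h.2⟩

/-- Equal letters are not sentinels. -/
theorem Input.ne_sentinel (h : Input T u w) {a b : ℕ} (hab : w[a]? = w[b]?) (h1 : a < b)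
    (h2 : b < w.length) : 0 < a ∧ (b + 1 = w.length → u ≠ []) := by
  obtain ⟨-, m, e, -⟩ := h
  have hb : (w ++ u)[a]? = (w ++ u)[b]? := by
    rw [List.getElem?_append_left (by omega), List.getElem?_append_left h2, hab]
  rw [e] at hb
  have hl := congrArg List.length e
  simp at hl
  constructor
  · by_contra h0
    obtain rfl : a = 0 := by omega
    obtain ⟨b, rfl⟩ : ∃ b', b = b' + 1 := ⟨b - 1, by omega⟩
    simp only [List.getElem?_cons_zero, List.getElem?_cons_succ] at hb
    have := List.mem_of_getElem? hb.symm
    simp at this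
  · rintro h3 rfl
    simp at hl
    obtain ⟨b, rfl⟩ : ∃ b', b = b' + 1 := ⟨b - 1, by omega⟩
    obtain rfl : b = m.length := by omega
    rcases a with _ | a
    · simp at hb
    · simp only [List.getElem?_cons_succ] at hb
      rw [List.getElem?_append_left (by simp; omega)] at hb
      rw [List.getElem?_append_right (by simp)] at hb
      simp at hb

theorem Input.pal_lt (h : Input T u w) {i r : ℕ} (hp : Pal w i r) (hi : 1 ≤ i) : r < i := by
  rcases Nat.eq_zero_or_pos r with rfl | hr
  · exact hi
  · have b := hp.1
    have b2 := hp.2.1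
    have := h.ne_sentinel (hp.2.2 (i - r) (i + r - 1) (by omega) (by omega) (by omega)) (by omega)
      (by omega)
    omega

/-- Deleting `yᴿ y` at the end of the working string -/
theorem Input.truncate (h : Input T u w) {k r : ℕ} (hz : Z w k r) (hk : k + 2 * r = w.length) :
    Input T u (w.take k) := by
  obtain ⟨x, y, z, e, hx, hy, hy0⟩ := hz.exists_append
  obtain ⟨-, m, e', hm⟩ := h
  have hl := congrArg List.length e
  simp at hl
  obtain rfl : z = [] := List.eq_nil_of_length_eq_zero (by omega)
  rw [e] at e'
  obtain ⟨m', h1, h2⟩ := sentinel_reduces (x := x) (z := u) hy0 (by simpa using e'.symm)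
  have h3 : w.take k = x ++ y := by
    rw [e, ← List.append_assoc, List.take_left' (by simp; omega)]
  refine ⟨by simp [h3, hy0], m', ?_, hm.tail h1⟩
  rw [h2, h3]
  simp

theorem Input.exists_of_nil (h : Input T [] w) : ∃ m : List α,
    w = Letter.dollar :: (m.map Letter.letter ++ [Letter.hash]) ∧ ReflTransGen Reduces T m := by
  simpa using h.2

theorem ZFree.irreducible_of_map {m : List α}
    (h : ZFree (Letter.dollar :: (m.map Letter.letter ++ [Letter.hash]))) : Irreducible m := by
  rintro ⟨v, x, y, z, hy, rfl, -⟩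
  refine irreducible_of_zFree h ⟨_, Letter.dollar :: x.map Letter.letter, y.map Letter.letter,
    z.map Letter.letter ++ [Letter.hash], by simpa using hy, by simp, rfl⟩

end Input

/-! ### Invariants of the algorithm -/

section Invariants

variable {α : Type} {β : Type*}

theorem take_length_of_prefix {w w' : List β} (h : w <+: w') : w.take w.length = w'.take w.length := by
  rw [List.take_length]
  exact List.prefix_iff_eq_take.1 h

theorem Pal.of_prefix {w w' : List β} {i r : ℕ} (hp : Pal w i r) (h : w <+: w') : Pal w' i r :=
  hp.congr hp.2.1 (take_length_of_prefix h) h.length_le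

theorem Closed.of_prefix {w w' : List β} {i p : ℕ} (hp : Closed w i p) (h : w <+: w') :
    Closed w' i p :=
  hp.congr hp.2.2.1 (take_length_of_prefix h) h.length_le

/-- A factor `y yᴿ y` does not end in a prefix without such factors. -/
theorem ZFree.lt_of_z {w : List β} {n i r : ℕ} (h : ZFree (w.take n)) (hz : Z w i r)
    (hn : n ≤ w.length) : n < i + 2 * r := by
  by_contra hle
  have e : w.take n = (w.take n).take n := by simp
  have hl : n ≤ (w.take n).length := by simp [hn]
  exact h i r ⟨hz.1, hz.2.1.congr (by omega) e hl, hz.2.2.congr (by omega) e hl⟩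

theorem ZFree.take_of_le {w : List β} {m n : ℕ} (h : ZFree (w.take n)) (hm : m ≤ n) :
    ZFree (w.take m) := by
  have e : w.take m = (w.take n).take m := by rw [List.take_take, min_eq_left hm]
  rw [e]
  rintro i r ⟨hr, h1, h2⟩
  have hp := List.take_prefix m (w.take n)
  exact h i r ⟨hr, h1.of_prefix hp, h2.of_prefix hp⟩

/-- The cell `Pals[i]` holds the radius of the maximal palindrome at the gap `i`, for good. -/
def Known (w : List β) (pals : ℕ → Option ℕ) (i : ℕ) : Prop :=
  ∃ p, pals i = some p ∧ Closed w i p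

/-- No gap strictly between `i` and `c` has a palindrome that reaches the gap `c`. -/
def Visible (w : List β) (c i : ℕ) : Prop :=
  ∀ j, i < j → j < c → ¬ Pal w j (c - j)

/-- What `Pals` has to say about the gaps `i` before `c` when `Stabilize(c)` is called: `Pals[i]`
is the radius of the maximal palindrome at `i` if this palindrome does not reach `c`, and
otherwise it only shows that the palindrome reaches `c`.  This is required of visible gaps only:
the procedure never looks at the other ones. -/
def Context (w : List β) (pals : ℕ → Option ℕ) (c : ℕ) : Prop :=
  ∀ i, 1 ≤ i → i < c → Visible w c i →
    ∃ p, pals i = some p ∧ (c ≤ i + p ∧ Pal w i (c - i) ∨ i + p < c ∧ Closed w i p)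

/-- The part of the invariants of `Stabilize(c)` that concerns the gaps before `b`, where `b` is the
length of the working string at the beginning of the call. -/
structure Frame (w : List β) (pals : ℕ → Option ℕ) (c b : ℕ) : Prop where
  one_le : 1 ≤ c
  lt : c < b
  le : b ≤ w.length
  free : ZFree (w.take (w.length - 1))
  ctx : Context w pals c
  mid : ∀ i, c < i → i < b → ∃ p, pals i = some p ∧ i + p < b ∧ Closed w i p

/-- `Pals[i]` is a copy of the entry at the mirror image of `i` with respect to `c`, where the
maximal palindrome does not reach `c`. -/
def Copied (w : List β) (pals : ℕ → Option ℕ) (c i : ℕ) : Prop :=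
  ∃ p, pals i = some p ∧ pals (2 * c - i) = some p ∧ c + p < i ∧ Closed w (2 * c - i) p

/-- The invariant of the while loop of `Stabilize(c)` -/
structure Loop (w : List β) (pals : ℕ → Option ℕ) (c b : ℕ) : Prop extends Frame w pals c b where
  pal : Pal w c (w.length - 1 - c)
  copied : ∀ i, b ≤ i → i < w.length → Copied w pals c i

/-- The stack `S`, read from its top, and a position `x` of a string of length `n`: each of
the palindromes centred at the entries of `S` is centred before the end of the preceding one (the
first one before `x`), and the last one ends just before the last letter. -/
def Chain (n : ℕ) (pals : ℕ → Option ℕ) : ℕ → List ℕ → Prop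
  | x, [] => x + 1 = n
  | x, e :: S => e ≤ x ∧ ∃ p, pals e = some p ∧ Chain n pals (e + p) S

/-- The invariant of the for loop of `Stabilize(c)` at the value `d` of its loop variable, where `E`
is the end of the palindrome at `c`: the entries for the gaps up to `d` are copies, and the later
ones are final. -/
structure ForInv (w : List β) (pals : ℕ → Option ℕ) (S : List ℕ) (c b d E : ℕ) : Prop
    extends Frame w pals c b where
  centre : ∃ p, pals c = some p ∧ c + p = E ∧ Closed w c p
  le_succ : b ≤ d + 1
  le_end : d ≤ E
  copied : ∀ i, b ≤ i → i ≤ d → Copied w pals c i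
  known : ∀ i, d < i → i < w.length → Known w pals i
  chain : Chain w.length pals E S
  lt_stack : ∀ e ∈ S, d < e

/-- The outcome of a call of `Stabilize(c)`, or of one of its rounds, that returns false: the
working string has been extended, and all palindromes at `c` and later are known and closed. -/
structure Settled (w : List β) (pals : ℕ → Option ℕ) (c b : ℕ) (w' : List β)
    (pals' : ℕ → Option ℕ) (S : List ℕ) : Prop where
  take : w'.take b = w.take b
  le : b ≤ w'.length
  agree : ∀ i, i < b → i ≠ c → pals' i = pals i
  free : ZFree (w'.take (w'.length - 1))
  known : ∀ i, c ≤ i → i < w'.length → Known w' pals' i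
  chain : ∃ p, pals' c = some p ∧ Chain w'.length pals' (c + p) S
  lt_stack : ∀ e ∈ S, c < e

/-- The outcome of a call of `Stabilize(c)` that returns true: the working string has been cut off
at the last gap `k ≤ c` whose palindrome reaches `c`. -/
def Returned (w : List β) (pals : ℕ → Option ℕ) (c : ℕ) (w' : List β)
    (pals' : ℕ → Option ℕ) : Prop :=
  ∃ k, k ≤ c ∧ w' = w.take k ∧ (∀ i, i ≤ k → i ≠ c → pals' i = pals i) ∧ Pal w k (c - k) ∧
    Visible w c k

theorem Visible.congr {w w' : List β} {c i : ℕ} (h : Visible w c i) (hw : w'.take c = w.take c)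
    (hl : c ≤ w.length) : Visible w' c i :=
  fun j h1 h2 hp => h j h1 h2 (hp.congr (by omega) hw hl)

theorem take_eq_of_le {w w' : List β} {m n : ℕ} (h : w'.take n = w.take n) (hm : m ≤ n) :
    w'.take m = w.take m := by
  have := congrArg (List.take m) h
  simpa [List.take_take, min_eq_left hm] using this

theorem Context.congr {w w' : List β} {pals pals' : ℕ → Option ℕ} {c : ℕ} (h : Context w pals c)
    (hw : w'.take c = w.take c) (hl' : c ≤ w'.length)
    (hp : ∀ i, i < c → pals' i = pals i) : Context w' pals' c := by
  intro i h1 h2 hv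
  obtain ⟨p, e, h3⟩ := h i h1 h2 (hv.congr hw.symm hl')
  refine ⟨p, (hp i h2).trans e, ?_⟩
  rcases h3 with ⟨h4, h5⟩ | ⟨h4, h5⟩
  · exact .inl ⟨h4, h5.congr (by omega) hw.symm hl'⟩
  · exact .inr ⟨h4, h5.congr (by omega) hw.symm hl'⟩

theorem Frame.congr {w w' : List β} {pals pals' : ℕ → Option ℕ} {c b : ℕ} (h : Frame w pals c b)
    (hw : w'.take b = w.take b) (hl' : b ≤ w'.length) (hf : ZFree (w'.take (w'.length - 1)))
    (hp : ∀ i, i < b → i ≠ c → pals' i = pals i) : Frame w' pals' c b where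
  one_le := h.one_le
  lt := h.lt
  le := hl'
  free := hf
  ctx := by
    have := h.lt
    exact h.ctx.congr (take_eq_of_le hw (by omega)) (by omega)
      fun i hi => hp i (by omega) (by omega)
  mid := fun i h1 h2 => by
    obtain ⟨p, e, h3, h4⟩ := h.mid i h1 h2
    exact ⟨p, (hp i h2 (by omega)).trans e, h3, h4.congr h3 hw.symm hl'⟩

theorem Copied.congr {w w' : List β} {pals pals' : ℕ → Option ℕ} {c i : ℕ} (h : Copied w pals c i)
    (hw : w'.take c = w.take c) (hl' : c ≤ w'.length) (hi : pals' i = pals i)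
    (hp : ∀ j, j < c → pals' j = pals j) : Copied w' pals' c i := by
  obtain ⟨p, h1, h2, h3, h4⟩ := h
  have := h4.2.1
  exact ⟨p, hi.trans h1, (hp _ (by omega)).trans h2, h3, h4.congr (by omega) hw.symm hl'⟩

theorem Settled.congr {w w₁ w' : List β} {pals pals₁ pals' : ℕ → Option ℕ} {c b : ℕ} {S : List ℕ}
    (h : Settled w₁ pals₁ c b w' pals' S) (hw : w₁.take b = w.take b)
    (hp : ∀ i, i < b → i ≠ c → pals₁ i = pals i) : Settled w pals c b w' pals' S :=
  { h with
    take := h.take.trans hw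
    agree := fun i h1 h2 => (h.agree i h1 h2).trans (hp i h1 h2) }

theorem Returned.congr {w w₁ w' : List β} {pals pals₁ pals' : ℕ → Option ℕ} {c : ℕ}
    (h : Returned w₁ pals₁ c w' pals') (hw : w₁.take c = w.take c) (hl : c ≤ w.length)
    (hl₁ : c ≤ w₁.length) (hp : ∀ i, i < c → pals₁ i = pals i) : Returned w pals c w' pals' := by
  obtain ⟨k, h1, h2, h3, h4, h5⟩ := h
  exact ⟨k, h1, h2.trans (take_eq_of_le hw h1), fun i hi hc => (h3 i hi hc).trans (hp i (by omega)),
    h4.congr (by omega) hw hl, h5.congr hw.symm hl₁⟩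

theorem Chain.congr {n : ℕ} {pals pals' : ℕ → Option ℕ} {x : ℕ} {S : List ℕ}
    (h : Chain n pals x S) (hp : ∀ e ∈ S, pals' e = pals e) : Chain n pals' x S := by
  induction S generalizing x with
  | nil => exact h
  | cons e S ih =>
    obtain ⟨h1, p, h2, h3⟩ := h
    exact ⟨h1, p, (hp e (by simp)).trans h2, ih h3 fun e' he => hp e' (by simp [he])⟩

/-! ### Extending the palindrome at the centre letter by letter -/

section SlowExtend

variable {T : List α} {u w : List (Letter α)} {pals : ℕ → Option ℕ} {c b r : ℕ}

/-- The left end of the palindrome at `c` is visible, so its entry tells whether there is a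
factor `y yᴿ y` with second fold `c` at the end of the working string. -/
theorem Loop.visible (h : Loop w pals c b) (hr : w.length = c + r + 1) :
    Visible w c (c - (r + 1)) := by
  intro j h1 h2 hp
  have hc := h.pal
  rw [show w.length - 1 - c = r by omega] at hc
  have := h.free.lt_of_z (i := j) (r := c - j) ⟨by omega, hp, by
    rw [show j + (c - j) = c by omega]; exact hc.mono (by omega)⟩ (by omega)
  omega

theorem Loop.pals_left (h : Loop w pals c b) (hr : w.length = c + r + 1) (hrc : r + 1 < c) :
    ∃ v, pals (c - (r + 1)) = some v ∧ (r + 1 ≤ v ∧ Pal w (c - (r + 1)) (r + 1) ∨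
      v < r + 1 ∧ Closed w (c - (r + 1)) v) := by
  obtain ⟨v, e, hv⟩ := h.ctx (c - (r + 1)) (by omega) (by omega) (h.visible hr)
  refine ⟨v, e, ?_⟩
  rcases hv with ⟨h1, h2⟩ | ⟨h1, h2⟩
  · exact .inl ⟨by omega, h2.mono (by omega)⟩
  · exact .inr ⟨by omega, h2⟩

/-- One more letter has been read, and the palindrome at `c` has been extended by one letter. -/
theorem Loop.extend (h : Loop w pals c b) (hr : w.length = c + r + 1) (hrc : r + 1 < c)
    (heq : w[c - r - 1]? = w[c + r]?) {v : ℕ} (hv : pals (c - (r + 1)) = some v) (hvr : v < r + 1)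
    (t : Letter α) :
    Loop (w ++ [t]) (Function.update pals (c + (r + 1)) (some v)) c b := by
  have hle := h.le
  have hlt := h.lt
  have hpal := h.pal
  rw [show w.length - 1 - c = r by omega] at hpal
  have hpal' := hpal.succ (by omega) (by omega) heq
  have hpre : w <+: w ++ [t] := List.prefix_append _ _
  have htake : ∀ n, n ≤ w.length → (w ++ [t]).take n = w.take n :=
    fun n hn => List.take_append_of_le_length hn
  have hclosed : Closed w (c - (r + 1)) v := by
    obtain ⟨v', e, h'⟩ := h.pals_left hr hrc
    obtain rfl : v = v' := Option.some.inj (hv.symm.trans e)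
    rcases h' with ⟨h1, -⟩ | ⟨-, h2⟩
    · omega
    · exact h2
  have hfree : ZFree w := by
    intro j s hz
    obtain ⟨e1, e2⟩ := Z.fold_eq (n := c + r) hr
      (by rw [show c + r = w.length - 1 by omega]; exact h.free)
      (hpal'.mono (by omega)) (by omega) hz
    have := hclosed.pal_le (r := r + 1) (by
      have := hz.2.1
      rwa [show j = c - (r + 1) by omega, show s = r + 1 by omega] at this)
    omega
  have hupd : ∀ i, i ≠ c + (r + 1) → Function.update pals (c + (r + 1)) (some v) i = pals i :=
    fun i hi => Function.update_of_ne hi _ _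
  refine ⟨h.toFrame.congr (htake b hle) (by simp; omega) (by simpa using hfree)
    fun i h1 _ => hupd i (by omega), ?_, ?_⟩
  · refine (hpal'.of_prefix hpre).mono ?_
    simp
    omega
  · intro i h1 h2
    simp at h2
    rcases Nat.lt_or_ge i w.length with h3 | h3
    · exact (h.copied i h1 h3).congr (htake c (by omega)) (by simp; omega) (hupd i (by omega))
        fun j hj => hupd j (by omega)
    · obtain rfl : i = c + (r + 1) := by omega
      refine ⟨v, by simp, ?_, by omega, ?_⟩
      · rw [hupd _ (by omega), show 2 * c - (c + (r + 1)) = c - (r + 1) by omega, hv]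
      · rw [show 2 * c - (c + (r + 1)) = c - (r + 1) by omega]
        exact hclosed.of_prefix hpre

theorem Loop.returned (h : Loop w pals c b) (hr : w.length = c + r + 1) (hrc : r + 1 < c)
    (heq : w[c - r - 1]? = w[c + r]?) {v : ℕ} (hv : pals (c - (r + 1)) = some v) (hvr : r + 1 ≤ v) :
    Z w (c - (r + 1)) (r + 1) ∧ Returned w pals c (w.take (c - (r + 1)))
      (fun i => if i ≤ c - (r + 1) then pals i else none) := by
  have hpal := h.pal
  rw [show w.length - 1 - c = r by omega] at hpal
  have hpal' := hpal.succ (by omega) (by omega) heq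
  have hp : Pal w (c - (r + 1)) (r + 1) := by
    obtain ⟨v', e, h'⟩ := h.pals_left hr hrc
    obtain rfl : v = v' := Option.some.inj (hv.symm.trans e)
    rcases h' with ⟨-, h1⟩ | ⟨h1, -⟩
    · exact h1
    · omega
  refine ⟨⟨by omega, hp, ?_⟩, c - (r + 1), by omega, rfl, ?_, hp.mono (by omega), h.visible hr⟩
  · rwa [show c - (r + 1) + (r + 1) = c by omega]
  · intro i hi _
    simp [hi]

/-- The palindrome at `c` is complete, and the for loop starts. -/
theorem Loop.forInv (h : Loop w pals c b) (hr : w.length = c + r + 1) (hrc : r < c)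
    (hne : w[c - r - 1]? ≠ w[c + r]?) :
    ForInv w (Function.update pals c (some r)) [] c b (c + r) (c + r) := by
  have hle := h.le
  have hlt := h.lt
  have hpal := h.pal
  rw [show w.length - 1 - c = r by omega] at hpal
  have hupd : ∀ i, i ≠ c → Function.update pals c (some r) i = pals i :=
    fun i hi => Function.update_of_ne hi _ _
  exact
    { h.toFrame.congr rfl hle h.free fun i _ h2 => hupd i h2 with
      centre := ⟨r, by simp, rfl, hpal, hrc, by omega, hne⟩
      le_succ := by omega
      le_end := le_rfl
      copied := fun i h1 h2 => (h.copied i h1 (by omega)).congr rfl (by omega)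
        (hupd i (by omega)) fun j hj => hupd j (by omega)
      known := fun i h1 h2 => by omega
      chain := hr.symm
      lt_stack := by simp }

end SlowExtend

/-! ### Extending a palindrome by means of the palindromes on the stack -/

section FastExtend

variable {T : List α} {u w : List (Letter α)} {pals : ℕ → Option ℕ} {d e x : ℕ}

/-- A palindrome at `d` continues to the right like the palindromes at `e > d` and at the mirror
image of `e` do. -/
theorem Pal.extend {w : List β} {d e i m : ℕ} (hd : Pal w d (e - d)) (hde : d < e)
    (hi : i + e = 2 * d) (he : Pal w e m) (hm : Pal w i m) (hmd : m ≤ e - d) :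
    Pal w d (e - d + m) := by
  have b1 := hm.1
  have b2 := he.2.1
  refine ⟨by omega, by omega, fun a b' hab h1 h2 => ?_⟩
  rcases Nat.lt_or_ge b' e with h3 | h3
  · exact hd.2.2 a b' hab h1 (by omega)
  · have e1 := he.2.2 (2 * e - 1 - b') b' (by omega) h3 (by omega)
    have e2 := hd.2.2 (2 * d - 1 - (2 * e - 1 - b')) (2 * e - 1 - b') (by omega) (by omega)
      (by omega)
    have e3 := hm.2.2 a (2 * d - 1 - (2 * e - 1 - b')) (by omega) (by omega) (by omega)
    rw [e3, e2, e1]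

/-- What `FastExtend(d)` finds when the palindrome at `d` is known to reach up to `x` and `e ≤ x` is
the top of the stack.  The mirror image of `e` is visible, and the entries at both are small,
since there would be a factor `y yᴿ y` with folds `d` and `e`, or with second fold `d`, otherwise. -/
theorem fast_compare (hin : Input T u w) (hfree : ZFree (w.take (w.length - 1)))
    (hctx : Context w pals d) (hd1 : 1 ≤ d) (hde : d < e) (hex : e ≤ x) (hx : x < w.length)
    (hpal : Pal w d (x - d)) {q : ℕ} (hq : Closed w e q) :
    e - d < d ∧ ∃ v, pals (d - (e - d)) = some v ∧
      (q ≤ v → Pal w d (e + q - d)) ∧ (v < q → Closed w d (e - d + v)) := by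
  have hlt := hin.pal_lt hpal hd1
  have hde' := hpal.mono (r' := e - d) (by omega)
  have hvis : Visible w d (d - (e - d)) := by
    intro j h1 h2 hp
    have := hfree.lt_of_z (i := j) (r := d - j) ⟨by omega, hp, by
      rw [show j + (d - j) = d by omega]; exact hpal.mono (by omega)⟩ (by omega)
    omega
  have hqd : q < e - d := by
    by_contra hge
    have := hfree.lt_of_z (i := d) (r := e - d) ⟨by omega, hde', by
      rw [show d + (e - d) = e by omega]; exact hq.1.mono (by omega)⟩ (by omega)
    have := hq.2.2.1
    omega
  obtain ⟨v, ev, hv⟩ := hctx (d - (e - d)) (by omega) (by omega) hvis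
  have hcl : d - (e - d) + v < d ∧ Closed w (d - (e - d)) v := by
    rcases hv with ⟨-, h2⟩ | h1
    · have := hfree.lt_of_z (i := d - (e - d)) (r := e - d)
        ⟨by omega, h2.mono (by omega), by
          rw [show d - (e - d) + (e - d) = d by omega]; exact hde'⟩ (by omega)
      omega
    · exact h1
  obtain ⟨hvd, hcl⟩ := hcl
  refine ⟨by omega, v, ev, fun hqv => ?_, fun hvq => ?_⟩
  · have := hde'.extend (i := d - (e - d)) hde (by omega) hq.1 (hcl.1.mono hqv) (by omega)
    rwa [show e - d + q = e + q - d by omega] at this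
  · have hp := hde'.extend (i := d - (e - d)) hde (by omega) (hq.1.mono hvq.le) hcl.1 (by omega)
    have hbd := hq.2.2.1
    refine hp.closed (hin.pal_lt hp hd1) (by omega) fun heq => ?_
    have hp' := hp.succ (hin.pal_lt hp hd1) (by omega) heq
    have := hp'.reflect (hq.1.mono hvq) (j := d - (e - d)) (by omega) (by omega) (by omega)
    have := hcl.pal_le this
    omega

end FastExtend

/-! ### The for loop -/

section ForLoop

variable {T : List α} {u w : List (Letter α)} {pals : ℕ → Option ℕ} {S : List ℕ} {c b d E : ℕ}

theorem ForInv.end_lt (h : ForInv w pals S c b d E) : E < w.length := by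
  obtain ⟨p, -, rfl, hp⟩ := h.centre
  exact hp.2.2.1

theorem ForInv.pal_centre (h : ForInv w pals S c b d E) {n : ℕ} (hn : n ≤ E) :
    Pal w c (n - c) := by
  obtain ⟨p, -, rfl, hp⟩ := h.centre
  exact hp.1.mono (by omega)

/-- A copied entry is final unless the palindrome reaches the end `E` of the one at `c`. -/
theorem ForInv.open_or_closed (h : ForInv w pals S c b d E) {i : ℕ} (h1 : b ≤ i) (h2 : i ≤ d) :
    ∃ p, pals i = some p ∧ (E ≤ i + p ∧ Pal w i (E - i) ∨ i + p < E ∧ Closed w i p) := by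
  obtain ⟨p, e1, -, e3, e4⟩ := h.copied i h1 h2
  obtain ⟨q, -, rfl, hq⟩ := h.centre
  have hle := h.le_end
  have hlt := h.lt
  have b1 := e4.2.1
  refine ⟨p, e1, ?_⟩
  rcases Nat.lt_or_ge (i + p) (c + q) with h3 | h3
  · exact .inr ⟨h3, Closed.reflect hq.1 e4 (by omega) (by omega) (by omega)⟩
  · exact .inl ⟨h3, hq.1.reflect (i := 2 * c - i) (e4.1.mono (by omega)) (by omega) (by omega)
      (by omega)⟩

/-- The context of a nested call `Stabilize(d)`: the gaps before `c` are no longer visible, since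
the palindrome at `c` reaches `d`. -/
theorem ForInv.context (h : ForInv w pals S c b d E) (hbd : b ≤ d) : Context w pals d := by
  have hlt := h.lt
  have hle := h.le_end
  intro i h1 h2 hv
  rcases lt_trichotomy i c with h3 | rfl | h3
  · exact (hv c h3 (by omega) (h.pal_centre hle)).elim
  · obtain ⟨p, e, h4, -⟩ := h.centre
    exact ⟨p, e, .inl ⟨by omega, h.pal_centre hle⟩⟩
  · rcases Nat.lt_or_ge i b with h4 | h4
    · obtain ⟨p, e, h5, h6⟩ := h.mid i h3 h4
      exact ⟨p, e, .inr ⟨by omega, h6⟩⟩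
    · obtain ⟨p, e, ⟨h5, h6⟩ | ⟨h5, h6⟩⟩ := h.open_or_closed h4 h2.le
      · exact ⟨p, e, .inl ⟨by omega, h6.mono (by omega)⟩⟩
      · rcases Nat.lt_or_ge (i + p) d with h7 | h7
        · exact ⟨p, e, .inr ⟨h7, h6⟩⟩
        · exact ⟨p, e, .inl ⟨h7, h6.1.mono (by omega)⟩⟩

/-- The preconditions of a nested call `Stabilize(d)` -/
theorem ForInv.loop (h : ForInv w pals S c b d E) (hbd : b ≤ d)
    (hp : Pal w d (w.length - 1 - d)) : Loop w pals d w.length := by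
  have hlt := h.lt
  have hle := h.le_end
  have hend := h.end_lt
  exact
    { one_le := by omega
      lt := by omega
      le := le_rfl
      free := h.free
      ctx := h.context hbd
      mid := fun i h1 h2 => by
        obtain ⟨p, e, h3⟩ := h.known i h1 h2
        exact ⟨p, e, h3.2.2.1, h3⟩
      pal := hp
      copied := fun i h1 h2 => by omega }

/-- The loop variable is decreased after the palindrome at `d` has become known. -/
theorem ForInv.next {w' : List (Letter α)} {pals' : ℕ → Option ℕ} {S' : List ℕ}
    (h : ForInv w pals S c b d E) (hbd : b ≤ d) (hw : w'.take w.length = w.take w.length)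
    (hl : w.length ≤ w'.length)
    (hp : ∀ i, i < d → pals' i = pals i) (hf : ZFree (w'.take (w'.length - 1)))
    (hk : ∀ i, d ≤ i → i < w'.length → Known w' pals' i) (hc : Chain w'.length pals' E S')
    (hS : ∀ e ∈ S', d ≤ e) : ForInv w' pals' S' c b (d - 1) E := by
  have hlt := h.lt
  have hle := h.le_end
  have hend := h.end_lt
  exact
    { h.toFrame.congr (take_eq_of_le hw h.le) (by omega) hf fun i h1 _ => hp i (by omega) with
      centre := by
        obtain ⟨p, e, h1, h2⟩ := h.centre
        exact ⟨p, (hp c (by omega)).trans e, h1, h2.congr h2.2.2.1 hw.symm hl⟩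
      le_succ := by omega
      le_end := by omega
      copied := fun i h1 h2 => (h.copied i h1 (by omega)).congr (take_eq_of_le hw (by omega))
        (by omega) (hp i (by omega)) fun j hj => hp j (by omega)
      known := fun i h1 h2 => hk i (by omega) h2
      chain := hc
      lt_stack := fun e he => by have := hS e he; omega }

theorem ForInv.next_skip (h : ForInv w pals S c b d E) (hbd : b ≤ d) {p : ℕ}
    (hp : pals d = some p) (hlt : d + p < E) : ForInv w pals S c b (d - 1) E := by
  refine h.next hbd rfl le_rfl (fun _ _ => rfl) h.free (fun i h1 h2 => ?_) h.chain
    fun e he => (h.lt_stack e he).le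
  rcases h1.eq_or_lt with rfl | h3
  · obtain ⟨p', e, h4⟩ := h.open_or_closed hbd le_rfl
    obtain rfl : p = p' := Option.some.inj (hp.symm.trans e)
    rcases h4 with ⟨h4, -⟩ | ⟨-, h4⟩
    · omega
    · exact ⟨p, e, h4⟩
  · exact h.known i h3 h2

theorem ForInv.next_fast (h : ForInv w pals S c b d E) (hbd : b ≤ d) {p : ℕ} {S' : List ℕ}
    (hp : Closed w d p) (hc : Chain w.length pals (d + p) S') (hS : ∀ e ∈ S', d < e) :
    ForInv w (Function.update pals d (some p)) (d :: S') c b (d - 1) E := by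
  have hupd : ∀ i, i ≠ d → Function.update pals d (some p) i = pals i :=
    fun i hi => Function.update_of_ne hi _ _
  refine h.next hbd rfl le_rfl (fun i hi => hupd i (by omega)) h.free (fun i h1 h2 => ?_)
    ⟨h.le_end, p, by simp, hc.congr fun e he => hupd e (by have := hS e he; omega)⟩ fun e he => ?_
  · rcases h1.eq_or_lt with rfl | h3
    · exact ⟨p, by simp, hp⟩
    · obtain ⟨q, e, h4⟩ := h.known i h3 h2
      exact ⟨q, (hupd i (by omega)).trans e, h4⟩
  · rcases List.mem_cons.1 he with rfl | he
    · exact le_rfl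
    · exact (hS e he).le

theorem ForInv.next_settled {w' : List (Letter α)} {pals' : ℕ → Option ℕ} {S' : List ℕ}
    (h : ForInv w pals S c b d E) (hbd : b ≤ d)
    (hs : Settled w pals d w.length w' pals' S') :
    ForInv w' pals' (d :: S') c b (d - 1) E := by
  have hle := h.le_end
  have hend := h.end_lt
  obtain ⟨p, e, hc⟩ := hs.chain
  refine h.next hbd hs.take hs.le (fun i hi => hs.agree i (by omega) (by omega)) hs.free hs.known
    ⟨hle, p, e, hc⟩ fun e he => ?_
  rcases List.mem_cons.1 he with rfl | he
  · exact le_rfl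
  · exact (hs.lt_stack e he).le

theorem ForInv.settled (h : ForInv w pals S c b d E) (hdb : d < b) :
    Settled w pals c b w pals S where
  take := rfl
  le := h.le
  agree := fun _ _ _ => rfl
  free := h.free
  known := fun i h1 h2 => by
    rcases h1.eq_or_lt with rfl | h3
    · obtain ⟨p, e, -, h4⟩ := h.centre
      exact ⟨p, e, h4⟩
    · rcases Nat.lt_or_ge i b with h4 | h4
      · obtain ⟨p, e, -, h5⟩ := h.mid i h3 h4
        exact ⟨p, e, h5⟩
      · exact h.known i (by omega) h2
  chain := by
    obtain ⟨p, e, h1, -⟩ := h.centre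
    exact ⟨p, e, h1 ▸ h.chain⟩
  lt_stack := fun e he => by
    have := h.lt_stack e he
    have := h.lt
    have := h.le_succ
    omega

/-- The position where a nested call `Stabilize(d)` has cut off the working string is `c` or one of
the gaps whose entries are copies. -/
theorem ForInv.cut (h : ForInv w pals S c b d E) (hbd : b ≤ d) {k : ℕ} (hkd : k ≤ d)
    (hp : Pal w k (d - k)) (hv : Visible w d k) : k = c ∨ b ≤ k := by
  have hlt := h.lt
  have hle := h.le_end
  by_contra hne
  push Not at hne
  rcases Nat.lt_or_ge k c with h1 | h1
  · exact hv c h1 (by omega) (h.pal_centre hle)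
  · obtain ⟨p, -, h2, h3⟩ := h.mid k (by omega) hne.2
    have := h3.pal_le hp
    omega

/-- A new round after the working string has been cut off at `k` and a letter has been read -/
theorem ForInv.loop_cut (h : ForInv w pals S c b d E) {k : ℕ} (hbk : b ≤ k) (hkd : k ≤ d)
    {pals' : ℕ → Option ℕ} (hp : ∀ i, i ≤ k → pals' i = pals i) (t : Letter α) :
    Loop (w.take k ++ [t]) pals' c b := by
  have hlt := h.lt
  have hle := h.le_end
  have hend := h.end_lt
  have hlen : (w.take k).length = k := by simp; omega
  have htake : ∀ n, n ≤ k → (w.take k ++ [t]).take n = w.take n := fun n hn => by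
    rw [List.take_append_of_le_length (by omega), List.take_take, min_eq_left hn]
  have hfree : ZFree (w.take k) := h.free.take_of_le (by omega)
  refine ⟨h.toFrame.congr (htake b hbk) (by simp; omega) ?_ fun i h1 _ => hp i (by omega), ?_, ?_⟩
  · rw [show (w.take k ++ [t]).length - 1 = k by simp; omega, htake k le_rfl]
    exact hfree
  · rw [show (w.take k ++ [t]).length - 1 = k by simp; omega]
    exact (h.pal_centre (n := k) (by omega)).congr (by omega) (htake k le_rfl).symm (by simp; omega)
  · intro i h1 h2
    simp at h2
    exact (h.copied i h1 (by omega)).congr (htake c (by omega)) (by simp; omega) (hp i (by omega))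
      fun j hj => hp j (by omega)

end ForLoop

end Invariants

/-! ### The procedures satisfy their specifications -/

section Procedures

variable {α : Type} {T : List α} {c b d : ℕ}

/-- The growth of the counters between two states: up to `n` more calls, `m` more pushes and `a` more
units of time than the letters read in between pay for.  In the potential behind the bound for the
time, a letter of `w` holds the unit for its deletion, an entry of the stack the `8` units for the
round of `FastExtend` that pops it, and an unread letter `70` units: `60` of them pay for one
iteration of a for loop, and the others for the round of `SlowExtend` that reads the letter. -/
structure Counts (s s' : State α) (n m a : ℤ) : Prop where
  unread : s'.unread.length ≤ s.unread.length
  calls : (s'.calls + s'.unread.length : ℤ) ≤ s.calls + s.unread.length + n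
  pushes : (s'.pushes + s'.unread.length : ℤ) ≤ s.pushes + s.unread.length + m
  pops : s'.pops + s'.stack.length + s.pushes ≤ s.pops + s.stack.length + s'.pushes
  time : (s'.time + s'.w.length + 8 * s'.stack.length + 70 * s'.unread.length : ℤ) ≤
    s.time + s.w.length + 8 * s.stack.length + 70 * s.unread.length + a

theorem Counts.trans {s s₁ s' : State α} {n m a n' m' a' n'' m'' a'' : ℤ} (h : Counts s s₁ n m a)
    (h' : Counts s₁ s' n' m' a') (hn : n + n' ≤ n'') (hm : m + m' ≤ m'') (ha : a + a' ≤ a'') :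
    Counts s s' n'' m'' a'' := by
  obtain ⟨h1, h2, h3, h4, h5⟩ := h
  obtain ⟨k1, k2, k3, k4, k5⟩ := h'
  constructor <;> omega

/-- The outcome of `SlowExtend(c)` -/
structure SlowPost (T : List α) (c b : ℕ) (s : State α) (res : Bool) (s' : State α) : Prop where
  input : Input T s'.unread s'.w
  stack : s'.stack = s.stack
  counts : Counts s s' 0 0 7
  of_true : res = true → Returned s.w s.pals c s'.w s'.pals ∧ s'.unread ≠ []
  of_false : res = false → s.w <+: s'.w ∧
    s'.w.length + s'.unread.length = s.w.length + s.unread.length ∧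
    (∀ i, i < b → i ≠ c → s'.pals i = s.pals i) ∧
    ForInv s'.w s'.pals [] c b (s'.w.length - 1) (s'.w.length - 1) ∧
    Counts s s' (s.w.length - s'.w.length) (s.w.length - s'.w.length)
      (60 * (s.w.length - s'.w.length) + 7)

/-- The outcome of a round of the while loop of `Stabilize(c)` and all later ones -/
structure WhilePost (T : List α) (c b : ℕ) (s : State α) (res : Bool) (s' : State α) : Prop where
  input : Input T s'.unread s'.w
  counts : Counts s s' (s.w.length - b) (s.w.length - b) (60 * (s.w.length - b) + 14)
  of_true : res = true → Returned s.w s.pals c s'.w s'.pals ∧ s'.stack = [] ∧ s'.unread ≠ []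
  of_false : res = false → Settled s.w s.pals c b s'.w s'.pals s'.stack

/-- The outcome of `Stabilize(c)` -/
structure StabilizePost (T : List α) (c : ℕ) (s : State α) (res : Bool) (s' : State α) :
    Prop where
  input : Input T s'.unread s'.w
  counts : Counts s s' 1 0 16
  of_true : res = true → Returned s.w s.pals c s'.w s'.pals ∧ s'.stack = [] ∧ s'.unread ≠ []
  of_false : res = false → Settled s.w s.pals c s.w.length s'.w s'.pals s'.stack

/-- The outcome of `FastExtend(d)` -/
structure FastPost (d : ℕ) (s : State α) (a : ℤ) (res : Bool) (s' : State α) : Prop where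
  unread : s'.unread = s.unread
  w : s'.w = s.w
  counts : Counts s s' 0 0 a
  of_true : res = true → s'.pals = s.pals ∧ s'.stack = [] ∧ Pal s.w d (s.w.length - 1 - d)
  of_false : res = false → ∃ p, s'.pals = Function.update s.pals d (some p) ∧ Closed s.w d p ∧
    Chain s.w.length s.pals (d + p) s'.stack ∧ ∀ e ∈ s'.stack, d < e

/-- The outcome of the for loop of `Stabilize(c)` from the value `d` of its loop variable on: there
is one unit of each budget for every value of the loop variable.  If a new round follows, the gaps
up to the last letter but one need their units again, and `12` units of time are put aside
for the beginning of that round. -/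
def ForPost (T : List α) (c b d : ℕ) (s : State α) (res : ForExit) (s' : State α) : Prop :=
  Input T s'.unread s'.w ∧
  match res with
  | .completed => Settled s.w s.pals c b s'.w s'.pals s'.stack ∧
      Counts s s' (d + 1 - b) (d + 1 - b) (60 * (d + 1 - b) + 1)
  | .returned => (Returned s.w s.pals c s'.w s'.pals ∧ s'.stack = [] ∧ s'.unread ≠ []) ∧
      Counts s s' (d + 1 - b) (d + 1 - b) (60 * (d + 1 - b) + 1)
  | .broken => Loop s'.w s'.pals c b ∧ s'.stack = [] ∧ s'.w.take b = s.w.take b ∧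
      (∀ i, i < b → s'.pals i = s.pals i) ∧ s'.unread.length < s.unread.length ∧
      Counts s s' (d + 1 - s'.w.length) (d + 1 - s'.w.length) (60 * (d + 1 - s'.w.length) - 12)

theorem ForPost.trans {s s₁ s' : State α} {res : ForExit} (h : ForPost T c b d s₁ res s')
    (hcb : c < b) (hb : b ≤ s.w.length) (hb₁ : b ≤ s₁.w.length)
    (hw : s₁.w.take b = s.w.take b) (hp : ∀ i, i < b → s₁.pals i = s.pals i)
    (hc : Counts s s₁ 1 1 60) : ForPost T c b (d + 1) s res s' := by
  obtain ⟨h1, h2⟩ := h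
  refine ⟨h1, ?_⟩
  cases res with
  | completed =>
    exact ⟨h2.1.congr hw fun i hi _ => hp i hi,
      hc.trans h2.2 (by push_cast; omega) (by push_cast; omega) (by push_cast; omega)⟩
  | returned =>
    obtain ⟨⟨h3, h4⟩, h5⟩ := h2
    exact ⟨⟨h3.congr (take_eq_of_le hw hcb.le) (by omega) (by omega) fun i hi => hp i (by omega),
      h4⟩, hc.trans h5 (by push_cast; omega) (by push_cast; omega) (by push_cast; omega)⟩
  | broken =>
    obtain ⟨h3, h4, h5, h6, h7, h8⟩ := h2
    exact ⟨h3, h4, h5.trans hw, fun i hi => (h6 i hi).trans (hp i hi),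
      h7.trans_le hc.unread,
      hc.trans h8 (by push_cast; omega) (by push_cast; omega) (by push_cast; omega)⟩

theorem fastLoop_ok (s : State α) {x : ℕ} (hin : Input T s.unread s.w)
    (hfree : ZFree (s.w.take (s.w.length - 1))) (hctx : Context s.w s.pals d) (hd : 1 ≤ d)
    (hdx : d ≤ x) (hx : x < s.w.length) (hpal : Pal s.w d (x - d))
    (hknown : ∀ i, d < i → i < s.w.length → Known s.w s.pals i)
    (hchain : Chain s.w.length s.pals x s.stack) (hS : ∀ e ∈ s.stack, d < e) :
    Ok (fastLoop d) s (FastPost d s 8) := by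
  induction hst : s.stack generalizing s x with
  | nil =>
    rw [fastLoop]
    simp only [ok_bind, ok_tick, ok_stackIsEmpty, hst, List.isEmpty_nil, if_true, ok_pure]
    rw [hst] at hchain
    have hchain : x + 1 = s.w.length := hchain
    refine ⟨rfl, rfl, ?_, fun _ => ⟨rfl, rfl, ?_⟩, by simp⟩
    · constructor <;> simp [hst]
      omega
    · rwa [show s.w.length - 1 - d = x - d by omega]
  | cons e S ih =>
    rw [hst] at hchain hS
    obtain ⟨hex, q, hq, hch⟩ := hchain
    have hde : d < e := hS e (by simp)
    obtain ⟨q', hq', hcl⟩ := hknown e hde (by omega)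
    obtain rfl : q = q' := Option.some.inj (hq.symm.trans hq')
    obtain ⟨hlt, v, hv, hpop, hbound⟩ :=
      fast_compare hin hfree hctx hd hde hex hx hpal hcl
    have hend := hcl.2.2.1
    rw [fastLoop]
    simp only [ok_bind, ok_tick, ok_stackIsEmpty, hst, List.isEmpty_cons, Bool.false_eq_true,
      if_false, ok_top, ok_sub, ok_palsAt]
    refine ⟨e, S, rfl, by omega, by omega, v, hv, q, by rwa [show d + (e - d) = e by omega], ?_⟩
    by_cases hqv : q ≤ v
    · rw [if_pos hqv]
      simp only [ok_bind, ok_pop]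
      refine ⟨e, S, rfl, ?_⟩
      refine Ok.mono (ih _ (x := e + q) hin hfree hctx (by omega) hend (hpop hqv) hknown hch
        (fun e' he => hS e' (by simp [he])) rfl) fun res s' hp => ?_
      refine ⟨hp.unread, hp.w, ?_, hp.of_true, hp.of_false⟩
      obtain ⟨h1, h2, h3, h4, h5⟩ := hp.counts
      have hl := congrArg List.length hst
      simp only [List.length_cons] at hl
      simp only at h1 h2 h3 h4 h5
      constructor <;> omega
    · rw [if_neg hqv]
      simp only [ok_bind, ok_setPals, ok_pure]
      have hcl' := hbound (by omega)
      have hend' := hcl'.2.2.1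
      refine ⟨⟨hd, by omega, by omega⟩, rfl, rfl, ?_, by simp, fun _ => ⟨_, rfl, hcl', ?_, ?_⟩⟩
      · constructor <;> simp [hst]
        omega
      · exact ⟨by omega, q, hq, hch⟩
      · exact hS

theorem fastExtend_ok {E : ℕ} (s : State α) (hin : Input T s.unread s.w)
    (h : ForInv s.w s.pals s.stack c b d E) (hbd : b ≤ d) {p : ℕ} (hp : s.pals d = some p)
    (hE : E ≤ d + p) : Ok (fastExtend d) s (FastPost d s 9) := by
  have hle := h.le_end
  have hlt := h.lt
  have hend := h.end_lt
  rw [fastExtend]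
  simp only [ok_bind, ok_tick]
  have hpal : Pal s.w d (E - d) := by
    obtain ⟨p', e, h'⟩ := h.open_or_closed hbd le_rfl
    obtain rfl : p = p' := Option.some.inj (hp.symm.trans e)
    rcases h' with ⟨-, h1⟩ | ⟨h1, -⟩
    · exact h1
    · omega
  refine Ok.mono (fastLoop_ok _ hin h.free (h.context hbd) (by omega) hle hend hpal h.known h.chain
    h.lt_stack) fun res s' hp => ⟨hp.unread, hp.w, ?_, hp.of_true, hp.of_false⟩
  obtain ⟨h1, h2, h3, h4, h5⟩ := hp.counts
  simp only at h1 h2 h3 h4 h5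
  constructor <;> omega

variable [DecidableEq α]

theorem slowLoop_ok (s : State α) (r : ℕ) (hin : Input T s.unread s.w)
    (h : Loop s.w s.pals c b) (hr : s.w.length = c + r + 1) :
    Ok (slowLoop c r) s (SlowPost T c b s) := by
  induction hn : s.unread.length using Nat.strong_induction_on generalizing s r with
  | _ n ih =>
    have hlt := h.lt
    have hle := h.le
    have hpal := h.pal
    rw [show s.w.length - 1 - c = r by omega] at hpal
    have hrc := hin.pal_lt hpal h.one_le
    rw [slowLoop]
    simp only [ok_bind, ok_tick, ok_letterAt, ok_sub]
    refine ⟨by omega, _, List.getElem?_eq_getElem (by omega), by omega, by omega, _,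
      List.getElem?_eq_getElem (by omega), ?_⟩
    by_cases heq : s.w[c + r + 1 - 1]'(by omega) = s.w[c - r - 1]'(by omega)
    · have heq' : s.w[c - r - 1]? = s.w[c + r]? := by
        rw [List.getElem?_eq_getElem (by omega), List.getElem?_eq_getElem (by omega), ← heq]
        rfl
      have hs := hin.ne_sentinel heq' (by omega) (by omega)
      have hun : s.unread ≠ [] := hs.2 (by omega)
      obtain ⟨v, hv, hv'⟩ := h.pals_left hr (by omega)
      rw [if_pos heq]
      simp only [ok_bind, ok_sub, ok_palsAt]
      refine ⟨by omega, v, hv, ?_⟩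
      by_cases hvr : r + 1 ≤ v
      · rw [if_pos hvr]
        simp only [ok_bind, ok_truncate, ok_pure]
        obtain ⟨h1, h2⟩ := h.returned hr (by omega) heq' hv hvr
        refine ⟨by omega, hin.truncate h1 (by omega), rfl, ?_, fun _ => ⟨h2, hun⟩, by simp⟩
        constructor <;> simp
        omega
      · rw [if_neg hvr]
        simp only [ok_bind, ok_setPals, ok_append]
        obtain ⟨t, u, hu⟩ := List.exists_cons_of_ne_nil hun
        have hul := congrArg List.length hu
        simp only [List.length_cons] at hul
        refine ⟨⟨by omega, by omega, by omega⟩, t, u, hu, ?_⟩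
        refine Ok.mono (ih u.length (by omega) _ (r + 1) (hu ▸ hin).append
          (h.extend hr (by omega) heq' hv (by omega) t) (by simp; omega) rfl) ?_
        intro res s' hpost
        have hupd : ∀ i, i < b → Function.update s.pals (c + (r + 1)) (some v) i = s.pals i :=
          fun i hi => Function.update_of_ne (by omega) _ _
        refine ⟨hpost.input, hpost.stack, ?_, fun ht => ?_, fun hf => ?_⟩
        · obtain ⟨h1, h2, h3, h4, h5⟩ := hpost.counts
          simp only [List.length_append, List.length_singleton] at h1 h2 h3 h4 h5
          constructor <;> omega
        · obtain ⟨h1, h2⟩ := hpost.of_true ht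
          exact ⟨h1.congr (List.take_append_of_le_length (by omega)) (by omega) (by simp; omega)
            fun i hi => hupd i (by omega), h2⟩
        · obtain ⟨h1, h2, h3, h4, h5⟩ := hpost.of_false hf
          refine ⟨(List.prefix_append _ _).trans h1, ?_,
            fun i hi hc => (h3 i hi hc).trans (hupd i hi), h4, ?_⟩
          · simp only [List.length_append, List.length_singleton] at h2
            omega
          · obtain ⟨k1, k2, k3, k4, k5⟩ := h5
            simp only [List.length_append, List.length_singleton] at k1 k2 k3 k4 k5
            constructor <;> omega
    · rw [if_neg heq]
      simp only [ok_bind, ok_setPals, ok_pure]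
      refine ⟨⟨h.one_le, by omega, by omega⟩, hin, rfl, ?_, by simp, fun _ => ⟨List.prefix_rfl, rfl,
        fun i _ hi => Function.update_of_ne hi _ _, ?_, ?_⟩⟩
      · constructor <;> simp
        omega
      · have := h.forInv hr hrc (fun he => heq (by
          rw [List.getElem?_eq_getElem (by omega), List.getElem?_eq_getElem (by omega)] at he
          exact (Option.some.inj he).symm))
        simpa only [show s.w.length - 1 = c + r by omega] using this
      · constructor <;> simp
        omega

theorem slowExtend_ok (s : State α) (hin : Input T s.unread s.w) (h : Loop s.w s.pals c b) :
    Ok (slowExtend c) s fun res s' => ∃ t, SlowPost T c b { s with time := t } res s' ∧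
      t = s.time + 3 := by
  have hlt := h.lt
  have hle := h.le
  rw [slowExtend]
  simp only [ok_bind, ok_tick, ok_lengthW, ok_sub]
  refine ⟨by omega, ?_⟩
  refine Ok.mono (slowLoop_ok _ _ hin h (by simp only; omega)) fun res s' hp => ⟨_, hp, rfl⟩

theorem stabilizeFor_ok {E N : ℕ} (s : State α)
    (ih : ∀ (s₁ : State α) (e : ℕ), s₁.unread.length ≤ N → Input T s₁.unread s₁.w →
      Loop s₁.w s₁.pals e s₁.w.length → s₁.stack = [] →
      Ok (stabilize e) s₁ (StabilizePost T e s₁))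
    (hN : s.unread.length ≤ N) (hin : Input T s.unread s.w)
    (h : ForInv s.w s.pals s.stack c b d E) :
    Ok (stabilizeFor c b d) s (ForPost T c b d s) := by
  induction d generalizing s with
  | zero =>
    have hlt := h.lt
    have hsucc := h.le_succ
    rw [stabilizeFor]
    simp only [ok_bind, ok_tick]
    rw [if_pos (by omega), ok_pure]
    refine ⟨hin, h.settled (by omega), ?_⟩
    constructor <;> simp <;> omega
  | succ d ihd =>
    have hlt := h.lt
    have hle := h.le
    have hsucc := h.le_succ
    have hdE := h.le_end
    have hend := h.end_lt
    rw [stabilizeFor]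
    simp only [ok_bind, ok_tick]
    by_cases hdb : d + 1 < b
    · rw [if_pos hdb, ok_pure]
      refine ⟨hin, h.settled hdb, ?_⟩
      constructor <;> simp <;> omega
    · have hbd : b ≤ d + 1 := by omega
      rw [if_neg hdb]
      simp only [ok_bind, ok_palsAt]
      obtain ⟨p, hp, hcopy, hpd, hcl⟩ := h.copied (d + 1) hbd le_rfl
      obtain ⟨q, hq, hqE, -⟩ := h.centre
      refine ⟨p, hp, q, hq, ?_⟩
      by_cases hopen : c + q ≤ d + 1 + p
      · rw [if_pos hopen]
        simp only [ok_bind]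
        refine Ok.mono (fastExtend_ok _ hin h hbd hp (by omega)) fun res s₁ hf => ?_
        have hfw := hf.w
        have hfu := hf.unread
        simp only at hfw hfu
        cases res with
        | false =>
          obtain ⟨p₁, hp₁, hcl₁, hch₁, hS₁⟩ := hf.of_false rfl
          have hnext := h.next_fast hbd hcl₁ hch₁ hS₁
          simp only at hp₁
          simp only [Bool.false_eq_true, if_false, ok_bind, ok_push, ok_sub]
          refine ⟨by omega, Ok.mono (ihd _ (by simpa only [hfu] using hN)
            (by simpa only [hfu, hfw] using hin)
            (by simpa only [hfw, hp₁, Nat.add_sub_cancel] using hnext)) fun res' s' hpost => ?_⟩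
          refine hpost.trans hlt hle (by simpa only [hfw] using hle) (by simp only [hfw])
            (fun i hi => ?_) ?_
          · simp only [hp₁]
            exact Function.update_of_ne (by omega) _ _
          · obtain ⟨h1, h2, h3, h4, h5⟩ := hf.counts
            simp only [hfw, hfu] at h1 h2 h3 h4 h5
            constructor <;> simp only [hfw, hfu, List.length_cons] <;> push_cast <;> omega
        | true =>
          obtain ⟨hp₁, hst₁, hpal⟩ := hf.of_true rfl
          simp only at hp₁ hpal
          have hloop := h.loop hbd hpal
          simp only [if_true, ok_bind]
          refine Ok.mono (ih s₁ (d + 1) (by simpa only [hfu] using hN) (by simpa only [hfu, hfw] using hin)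
            (by simpa only [hfw, hp₁] using hloop) hst₁) fun res s₂ hs => ?_
          have hcf := hf.counts
          have hcs := hs.counts
          cases res with
          | false =>
            have hset := hs.of_false rfl
            rw [hfw, hp₁] at hset
            have hnext := h.next_settled hbd hset
            simp only [Bool.false_eq_true, if_false, ok_bind, ok_push, ok_sub]
            refine ⟨by omega, Ok.mono (ihd _ (by
              have := hcs.unread
              rw [hfu] at this
              exact this.trans hN) hs.input hnext) fun res' s' hpost => ?_⟩
            have hle₂ := hset.le
            refine hpost.trans hlt hle (hle.trans hset.le) (take_eq_of_le hset.take hle)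
              (fun i hi => hset.agree i (by omega) (by omega)) ?_
            obtain ⟨h1, h2, h3, h4, h5⟩ := hcf
            obtain ⟨k1, k2, k3, k4, k5⟩ := hcs
            simp only [hfw, hfu] at h1 h2 h3 h4 h5 k1 k2 k3 k4 k5
            constructor <;> simp only [List.length_cons] <;> push_cast <;> omega
          | true =>
            obtain ⟨hret, hst₂, hun₂⟩ := hs.of_true rfl
            rw [hfw, hp₁] at hret
            obtain ⟨k, hkd, hw₂, hag, hpk, hvis⟩ := hret
            have hlen : s₂.w.length = k := by rw [hw₂]; simp; omega
            simp only [if_true, ok_bind, ok_lengthW]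
            rcases h.cut hbd hkd hpk hvis with hkc | hbk
            · -- the outer call returns true as well
              rw [if_pos (by omega), ok_pure]
              refine ⟨hs.input, ⟨⟨k, by omega, hw₂, fun i hi _ => hag i hi (by omega), ?_, ?_⟩,
                hst₂, hun₂⟩, ?_⟩
              · rw [hkc, Nat.sub_self]
                exact pal_zero (by omega)
              · intro j h1 h2
                omega
              · obtain ⟨h1, h2, h3, h4, h5⟩ := hcf
                obtain ⟨k1, k2, k3, k4, k5⟩ := hcs
                simp only [hfw, hfu] at h1 h2 h3 h4 h5 k1 k2 k3 k4 k5
                constructor <;> simp only <;> push_cast <;> omega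
            · -- a new round
              obtain ⟨t, u, hu⟩ := List.exists_cons_of_ne_nil hun₂
              have hul := congrArg List.length hu
              simp only [List.length_cons] at hul
              have hin' : Input T u (s₂.w ++ [t]) := (hu ▸ hs.input).append
              have finish : ∀ (pals' : ℕ → Option ℕ) (a : ℕ), a ≤ s₂.time + 5 →
                  (∀ i, i ≤ k → pals' i = s.pals i) →
                  ForPost T c b (d + 1) s .broken { s₂ with
                    time := a, unread := u, w := s₂.w ++ [t], pals := pals' } := by
                intro pals' a ha hpals
                have hl := h.loop_cut hbk hkd hpals t
                rw [← hw₂] at hl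
                refine ⟨hin', hl, hst₂, ?_, fun i hi => hpals i (by omega), ?_, ?_⟩
                · simp only
                  rw [List.take_append_of_le_length (by omega), hw₂, List.take_take,
                    min_eq_left hbk]
                · have := hcs.unread
                  simp only [hfu] at this ⊢
                  omega
                · obtain ⟨h1, h2, h3, h4, h5⟩ := hcf
                  obtain ⟨k1, k2, k3, k4, k5⟩ := hcs
                  simp only [hfw, hfu] at h1 h2 h3 h4 h5 k1 k2 k3 k4 k5
                  constructor <;> simp only [List.length_append, List.length_singleton] <;>
                    push_cast <;> omega
              rw [if_neg (by omega)]
              -- the nested call may have changed the entry of its centre, which is restored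
              by_cases hdk : d + 1 = k
              · rw [if_pos (by omega)]
                simp only [ok_bind, ok_sub, ok_palsAt, ok_setPals, ok_append, ok_pure]
                have h2c := hcl.2.1
                refine ⟨by omega, p, ?_, ⟨by omega, by omega, by omega⟩, t, u, hu,
                  finish _ _ (by omega) fun i hi => ?_⟩
                · rw [hag _ (by omega) (by omega), hcopy]
                · rcases eq_or_ne i (d + 1) with rfl | hne
                  · simp [hp]
                  · rw [Function.update_of_ne hne, hag i hi hne]
              · rw [if_neg (by omega)]
                simp only [ok_bind, ok_append, ok_pure]
                exact ⟨t, u, hu, finish _ _ (by omega) fun i hi => hag i hi (by omega)⟩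
      · rw [if_neg hopen]
        simp only [ok_bind, ok_sub]
        have hnext := h.next_skip hbd hp (by omega)
        refine ⟨by omega, Ok.mono (ihd _ hN hin hnext) fun res' s' hpost =>
          hpost.trans hlt hle hle rfl (fun _ _ => rfl) ?_⟩
        constructor <;> simp only <;> push_cast <;> omega

theorem stabilize_ok_of_while (s : State α)
    (h : ∀ t n, Ok (stabilizeWhile c s.w.length) { s with time := t, calls := n }
      (WhilePost T c s.w.length { s with time := t, calls := n })) :
    Ok (stabilize c) s (StabilizePost T c s) := by
  rw [stabilize]
  simp only [ok_bind, ok_recordCall, ok_lengthW]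
  refine Ok.mono (h _ _) fun res s' hp => ⟨hp.input, ?_, hp.of_true, hp.of_false⟩
  obtain ⟨h1, h2, h3, h4, h5⟩ := hp.counts
  simp only at h1 h2 h3 h4 h5
  constructor <;> push_cast at * <;> omega

/-- The while loop of `Stabilize(c)` terminates because every nested call and every new round is
preceded by the reading of a letter, except for nested calls in a later round; these start their
own first round. -/
theorem stabilizeWhile_ok (s : State α) (hin : Input T s.unread s.w)
    (h : Loop s.w s.pals c b) (hst : s.stack = []) :
    Ok (stabilizeWhile c b) s (WhilePost T c b s) := by
  induction hn : 2 * s.unread.length + (if b < s.w.length then 1 else 0)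
    using Nat.strong_induction_on generalizing s c b with
  | _ n ih =>
    have hlt := h.lt
    have hle := h.le
    rw [stabilizeWhile]
    simp only [ok_bind, ok_tick]
    refine Ok.mono (slowExtend_ok _ hin h) fun res s₁ hpost => ?_
    obtain ⟨t, hslow, ht⟩ := hpost
    have hc₁ := hslow.counts
    have hst₁ := hslow.stack
    simp only [hst] at hst₁
    cases res with
    | true =>
      simp only [if_true, ok_pure]
      obtain ⟨h1, h2⟩ := hslow.of_true rfl
      refine ⟨hslow.input, ?_, fun _ => ⟨h1, hst₁, h2⟩, by simp⟩
      obtain ⟨h1, h2, h3, h4, h5⟩ := hc₁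
      simp only at h1 h2 h3 h4 h5 ht
      constructor <;> omega
    | false =>
      obtain ⟨hpre, hsum, hag, hfor, hcf⟩ := hslow.of_false rfl
      simp only at hpre hsum hag
      have hlen := hpre.length_le
      have htake : s₁.w.take b = s.w.take b := (take_eq_of_le (take_length_of_prefix hpre) hle).symm
      obtain ⟨p, hp, hpE, -⟩ := hfor.centre
      simp only [Bool.false_eq_true, if_false, ok_bind, ok_palsAt]
      refine ⟨p, hp, ?_⟩
      rw [hpE]
      have hf : Ok (stabilizeFor c b (s₁.w.length - 1)) { s₁ with time := s₁.time + 1 }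
          (ForPost T c b (s₁.w.length - 1) { s₁ with time := s₁.time + 1 }) := by
        -- the for loop has an empty range unless letters have been read since the call
        by_cases hb : b < s₁.w.length
        · refine stabilizeFor_ok (N := s₁.unread.length) _ (fun s₂ e h1 h2 h3 h4 =>
            stabilize_ok_of_while s₂ fun t n => ih _ ?_ _ h2 h3 h4 rfl) le_rfl hslow.input
            (by simpa only [hst₁] using hfor)
          simp only [lt_irrefl, if_false]
          split at hn <;> omega
        · rw [stabilizeFor]
          simp only [ok_bind, ok_tick]
          rw [if_pos (by omega), ok_pure]
          refine ⟨hslow.input, by simpa only [hst₁] using hfor.settled (by omega), ?_⟩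
          constructor <;> simp only <;> push_cast <;> omega
      refine Ok.mono hf fun res s₂ hpost => ?_
      obtain ⟨hin₂, hpost⟩ := hpost
      have hc₂ : Counts s { s₁ with time := s₁.time + 1 } (s.w.length - s₁.w.length)
          (s.w.length - s₁.w.length) (60 * (s.w.length - s₁.w.length) + 12) := by
        obtain ⟨h1, h2, h3, h4, h5⟩ := hcf
        simp only at h1 h2 h3 h4 h5 ht
        constructor <;> push_cast <;> omega
      cases res with
      | completed =>
        simp only [ok_pure]
        obtain ⟨h1, h2⟩ := hpost
        exact ⟨hin₂, hc₂.trans h2 (by omega) (by omega) (by omega), by simp,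
          fun _ => h1.congr htake hag⟩
      | returned =>
        simp only [ok_pure]
        obtain ⟨⟨h1, h2⟩, h3⟩ := hpost
        exact ⟨hin₂, hc₂.trans h3 (by omega) (by omega) (by omega), fun _ =>
          ⟨h1.congr (take_eq_of_le htake hlt.le) (by omega) (by simp only; omega)
            fun i hi => hag i (by omega) (by omega), h2⟩, by simp⟩
      | broken =>
        obtain ⟨h1, h2, h3, h4, h5, h6⟩ := hpost
        have hle₂ := h1.le
        simp only at h3 h4 h5
        have hun := hc₂.unread
        simp only at hun
        refine Ok.mono (ih _ ?_ _ hin₂ h1 h2 rfl) fun res s₃ hw => ?_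
        · split at hn <;> split <;> omega
        · refine ⟨hw.input, ?_, fun ht => ?_, fun hf => ?_⟩
          · exact (hc₂.trans h6 le_rfl le_rfl le_rfl).trans hw.counts (by omega) (by omega)
              (by omega)
          · obtain ⟨k1, k2⟩ := hw.of_true ht
            exact ⟨k1.congr (take_eq_of_le (h3.trans htake) hlt.le) (by omega) (by omega)
              fun i hi => (h4 i (by omega)).trans (hag i (by omega) (by omega)), k2⟩
          · exact (hw.of_false hf).congr (h3.trans htake) fun i hi hc =>
              (h4 i hi).trans (hag i hi hc)

end Procedures

/-! ### Reading the whole input -/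

section Main

variable {α : Type} {T : List α}

/-- The invariant of the loop of `ZReduce`: the working string is irreducible, and all palindromes
before its end are known and closed. -/
structure Stable (T : List α) (s : State α) : Prop where
  input : Input T s.unread s.w
  known : ∀ i, 1 ≤ i → i < s.w.length → Known s.w s.pals i
  free : ZFree s.w

theorem Stable.loop {s : State α} (h : Stable T s) (t : Letter α) :
    Loop (s.w ++ [t]) s.pals s.w.length (s.w ++ [t]).length := by
  have hpos := List.length_pos_iff.2 h.input.1
  have hpre : s.w <+: s.w ++ [t] := List.prefix_append _ _
  exact
    { one_le := hpos
      lt := by simp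
      le := le_rfl
      free := by simpa using h.free
      ctx := fun i h1 h2 _ => by
        obtain ⟨p, e, h3⟩ := h.known i h1 h2
        exact ⟨p, e, .inr ⟨h3.2.2.1, h3.of_prefix hpre⟩⟩
      mid := fun i h1 h2 => by
        simp at h2
        omega
      pal := (pal_zero (by simp)).mono (by simp)
      copied := fun i h1 h2 => by omega }

theorem Settled.stable {s s' : State α} (h : Stable T s) {t : Letter α}
    (hin : Input T s'.unread s'.w)
    (hs : Settled (s.w ++ [t]) s.pals s.w.length (s.w ++ [t]).length s'.w s'.pals s'.stack) :
    Stable T s' := by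
  have hpos := List.length_pos_iff.2 h.input.1
  have hle := hs.le
  simp only [List.length_append, List.length_singleton] at hle
  have htake : s'.w.take s.w.length = s.w.take s.w.length := by
    rw [take_eq_of_le hs.take (by simp), List.take_append_of_le_length le_rfl]
  have hk : ∀ i, 1 ≤ i → i < s'.w.length → Known s'.w s'.pals i := by
    intro i h1 h2
    rcases Nat.lt_or_ge i s.w.length with h3 | h3
    · obtain ⟨p, e, h4⟩ := h.known i h1 h3
      exact ⟨p, (hs.agree i (by simp; omega) (by omega)).trans e,
        h4.congr h4.2.2.1 htake.symm (by omega)⟩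
    · exact hs.known i h3 h2
  refine ⟨hin, hk, fun i r hz => ?_⟩
  have h1 := hs.free.lt_of_z hz (by omega)
  have h2 := hz.2.2.2.1
  obtain ⟨hr, -, h3⟩ := hz
  obtain ⟨p, -, h4⟩ := hk (i + r) (by omega) (by omega)
  have := h4.pal_le h3
  have := h4.2.2.1
  omega

/-- If `Stabilize` returns true, then only the letters read during its call have been deleted. -/
theorem Returned.stable {s s' : State α} (h : Stable T s) {t : Letter α}
    (hin : Input T s'.unread s'.w)
    (hs : Returned (s.w ++ [t]) s.pals s.w.length s'.w s'.pals) : Stable T s' := by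
  obtain ⟨k, h1, h2, h3, h4, h5⟩ := hs
  rw [List.take_append_of_le_length h1] at h2
  have hk : k = s.w.length := by
    by_contra hne
    have hk0 : 1 ≤ k := by
      have := List.length_pos_iff.2 hin.1
      rw [h2] at this
      simp at this
      omega
    obtain ⟨p, -, h6⟩ := h.known k hk0 (by omega)
    have := (h6.of_prefix (List.prefix_append _ [t])).pal_le h4
    have := h6.2.2.1
    omega
  subst hk
  rw [List.take_length] at h2
  refine ⟨hin, fun i hi1 hi2 => ?_, h2 ▸ h.free⟩
  rw [h2] at hi2 ⊢
  obtain ⟨p, e, h6⟩ := h.known i hi1 hi2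
  exact ⟨p, (h3 i hi2.le hi2.ne).trans e, h6⟩

variable [DecidableEq α]

theorem zReduceLoop_ok (s : State α) (h : Stable T s) :
    Ok zReduceLoop s fun _ s' => Stable T s' ∧ s'.unread = [] ∧ Counts s s' 0 0 2 := by
  induction hn : s.unread.length using Nat.strong_induction_on generalizing s with
  | _ n ih =>
    rw [zReduceLoop]
    simp only [ok_bind, ok_tick, ok_inputRemains]
    rcases hu : s.unread with _ | ⟨t, u⟩
    · simp only [List.isEmpty_nil, Bool.not_true, Bool.false_eq_true, if_false, ok_pure]
      refine ⟨⟨by simpa only [hu] using h.input, h.known, h.free⟩, trivial, ?_⟩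
      constructor <;> simp [hu]
      omega
    · have hin := h.input
      rw [hu] at hin
      have hloop := h.loop t
      have hul := congrArg List.length hu
      simp only [List.length_cons] at hul
      simp only [List.isEmpty_cons, Bool.not_false, if_true, ok_bind, ok_append, ok_clearStack,
        ok_lengthW, ok_sub]
      refine ⟨t, u, rfl, by simp, ?_⟩
      rw [show (s.w ++ [t]).length - 1 = s.w.length by simp]
      refine Ok.mono (stabilize_ok_of_while _ fun _ _ =>
        stabilizeWhile_ok _ hin.append hloop rfl) fun res s₁ hs => ?_
      have hst : Stable T s₁ := by
        cases res with
        | true => exact (hs.of_true rfl).1.stable h hs.input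
        | false => exact (hs.of_false rfl).stable h hs.input
      have hc : Counts s s₁ 0 0 0 := by
        obtain ⟨h1, h2, h3, h4, h5⟩ := hs.counts
        simp only [List.length_append, List.length_singleton, List.length_nil] at h1 h2 h3 h4 h5
        constructor <;> omega
      have hlt : s₁.unread.length ≤ u.length := hs.counts.unread
      exact Ok.mono (ih _ (by omega) _ hst rfl) fun _ s' h' =>
        ⟨h'.1, h'.2.1, hc.trans h'.2.2 (by omega) (by omega) (by omega)⟩

theorem zReduceMain_ok (T : List α) :
    Ok zReduceMain (initialState T) fun v s => ∃ u : List α, v = u.map Letter.letter ∧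
      IsZNormalForm T u ∧ s.time ≤ 77 * (T.length + 1) ∧ s.calls ≤ T.length + 1 ∧
      s.pops ≤ s.pushes ∧ s.pushes ≤ T.length + 1 := by
  rw [zReduceMain]
  simp only [ok_bind, ok_append, ok_get, ok_tick, ok_pure]
  refine ⟨_, _, rfl, ?_⟩
  refine Ok.mono (zReduceLoop_ok (T := T) _ ⟨⟨by simp [initialState], T, by simp [initialState],
    Relation.ReflTransGen.refl⟩, ?_, ?_⟩) fun _ s h => ?_
  · simp [initialState]
    omega
  · rintro i r ⟨hr, h1, h2⟩
    have := h1.1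
    have := h2.2.1
    simp [initialState] at this
    omega
  · obtain ⟨hs, hu, h1, h2, h3, h4, h5⟩ := h
    have hin := hs.input
    rw [hu] at hin
    obtain ⟨m, e, hm⟩ := hin.exists_of_nil
    have hfree := hs.free
    simp [initialState, hu] at h1 h2 h3 h4 h5
    refine ⟨m, ?_, ⟨hm, ZFree.irreducible_of_map (e ▸ hfree)⟩, ?_, ?_, ?_, ?_⟩
    · rw [e]
      simp
    all_goals omega

end Main

end ZRed

theorem mainTheorem1 :
    ∃ C : ℕ, ∀ (α : Type) [DecidableEq α] (T : List α),
      ∃ (u : List α) (s : ZRed.State α),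
        ZRed.zReduce T = some (u.map ZRed.Letter.letter, s) ∧
        ZRed.IsZNormalForm T u ∧
        (∀ v : List α, ZRed.IsZNormalForm T v → v = u) ∧
        s.time ≤ C * (T.length + 1) ∧
        s.calls ≤ T.length + 1 ∧
        s.pops ≤ s.pushes ∧
        s.pushes ≤ T.length + 1 := by
  refine ⟨77, fun α _ T => ?_⟩
  obtain ⟨v, s, h, u, rfl, hu, hc⟩ := ZRed.zReduceMain_ok T
  exact ⟨u, s, h, hu, fun v hv => hv.unique hu, hc⟩
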